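/- **Setting.** Let $\Lambda$ be the vertex set of the $L_0\times L_0$ square lattice with periodic boundary conditions, $\Omega=\{\pm1\}^\Lambda$, $\mathcal H=\mathbb C[\Omega]$. For each edge $e=\{i,j\}$ let $C_e=\frac{1-Z_iZ_j}{2}$ (the check of $e$; it is excited if it equals $1$), and let $H_0=J\sum_e C_e$ with $J>0$. A bottleneck indicator is given by a finite set $B$ of checks; $L_B=|B|$, $E_B=\sum_{e\in B}C_e$, and the indicator equals $1$ on states on which all checks of $B$ are excited. For $A\subset\Lambda$ let $\ell_A$ be the map flipping the spins in $A$, and $\partial A$ the set of sites of $A$ having a neighbour outside $A$. An operator is $R$-local if it is a linear combination of operators each supported on at most $R$ sites. **Proposition.** There is a constant $c_\partial>0$ such that for every integer $R\ge1$ there are constants $\theta,c_R>0$, depending only on $R$, such that for all sufficiently large $L_0$ (depending only on $R$) and all $J>0$ the following holds with $\Delta=0.6J$ and $L=c_RL_0$. There are sets $W_k,\Phi_k\subset\Omega$ ($k=1,2$), finite families $\mathcal B_1,\mathcal B_2,\mathcal B_{\rm out}$ of bottleneck indicators, and $P_k=W_k\cup\Phi_k$ (the same letters denote the spanned subspaces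 of $\mathcal H$ and their orthogonal projectors), such that: 1. *(Symmetric bottleneck structure.)* Configurations in different wells $W_1,W_2$ have Hamming distance $>R$; $W_k\cap\Phi_k=\emptyset$, and $P_k$ contains all configurations within Hamming distance $R$ of $W_k$; every $\mathbf z\in\Phi_k$ has all checks of some $B\in\mathcal B_k$ excited; and any two of the pairs $(W_k,\Phi_k)$ are related by the identity or the global spin flip. The corresponding statements hold for the subspaces: $W_{k'}\mathcal OW_k=0$ for $k\ne k'$ and $\mathcal O W_k\subset P_k$ for all $R$-local $\mathcal O$; $\Phi_k\perp W_k$ has an orthonormal basis of states each fixed by the projector of an indicator in $\mathcal B_k$; for each $B\in\mathcal B_k$ this projector maps $\Phi_k$ to itself and the spectral projectors of $E_B$ map $P_k$ to itself. The checks are commuting orthogonal projectors; each acts on at most $4$ sites and each site is acted on by at most $4$ checks. 2. *($(\Delta,\theta,L,R)$-global Peierls condition.)* $(1-P_k)H_0W_k=0$; $|\mathcal B_k|\le e^{\theta L}$ and $L_B\ge L$ for $B\in\mathcal B_k$; for every $B\in\mathcal B_k$ and every unit vector $\psi\in P_k$ in the spectral subspace $E_B\ge\frac45L_B$, $\langle\psi|H_0|\psi\rangle\ge\Delta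 L_B+H_{k,\min}$, where $H_{k,\min}$ is the lowest energy in $P_k$. Moreover $P_kP_{k'}=P_kH_0P_{k'}=0$ for $k\neq k'$; the orthogonal complement of $P_1+P_2$ has an orthonormal basis of states each fixed by the projector of an indicator in $\mathcal B_{\rm out}$; for every $B\in\mathcal B_{\rm out}$, $L_B\ge L$, and every unit vector $\psi$ in the spectral subspace $E_B\ge\frac45L_B$ satisfies $\langle\psi|H_0|\psi\rangle\ge\Delta L_B+H_{\min}$, where $H_{\min}$ is the lowest eigenvalue of $H_0$; for each $L'\in\mathbb N$ at most $e^{\theta L'}$ of the $B\in\mathcal B_{\rm out}$ have $L_B=L'$. 3. *(Order parameter.)* With $A=\frac1{|\Lambda|}\sum_{i\in\Lambda}Z_i$, one has $P_1AP_1>\frac14$ on $P_1$ and $P_2AP_2<-\frac14$ on $P_2$, i.e. $\langle\psi|A|\psi\rangle>\frac14\|\psi\|^2$ for $0\ne\psi\in P_1$ and $\langle\psi|A|\psi\rangle<-\frac14\|\psi\|^2$ for $0\neq\psi\in P_2$. 4. *(Strengthened energy condition.)* For each $B\in\mathcal B_k$ ($k=1,2$) and each $B\in\mathcal B_{\rm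 out}$ there is $A\subset\Lambda$ with $|\partial A|\le c_\partial L_B$ such that $H_0(\mathbf z)\ge\Delta L_B+H_0(\ell_A\mathbf z)$ for every $\mathbf z\in\Omega$ with $E_B(\mathbf z)\ge\frac45L_B$. For $B\in\mathcal B_k$ the set $A$ may moreover be chosen such that $\ell_A\mathbf z\in P_k$ whenever $\mathbf z\in P_k$ and all checks of $B$ are excited in $\mathbf z$. -/

import Mathlib

open scoped InnerProductSpace

noncomputable section

namespace Peierls

/-! ## Many-body Hilbert space, local operators, checks -/

/-- The Hilbert space `ℂ[Ω]` of a system of qudits: `Ω = (Λ → S)` is the set of classical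
configurations (`S` is the set of basis states of one qudit), with the standard inner product. -/
abbrev QSpace (Λ S : Type) : Type := EuclideanSpace ℂ (Λ → S)

/-- Operators on the many-body Hilbert space. -/
abbrev QOp (Λ S : Type) [Fintype Λ] [DecidableEq Λ] [Fintype S] : Type :=
  QSpace Λ S →L[ℂ] QSpace Λ S

section Operators

variable {Λ S ι : Type} [Fintype Λ] [DecidableEq Λ] [Fintype S] [DecidableEq S]

/-- The computational basis vector `|z⟩`. -/
def ket (z : Λ → S) : QSpace Λ S := EuclideanSpace.single z (1 : ℂ)

/-- The operator which is diagonal in the computational basis, with `|z⟩ ↦ f z • |z⟩`. -/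
def diagOp (f : (Λ → S) → ℝ) : QOp Λ S :=
  Matrix.toEuclideanCLM (n := Λ → S) (𝕜 := ℂ) (Matrix.diagonal fun z => (f z : ℂ))

/-- The subspace spanned by the basis vectors of a set of classical configurations. -/
def spanKets (X : Set (Λ → S)) : Submodule ℂ (QSpace Λ S) :=
  Submodule.span ℂ (ket '' X)

/-- `O = M_A ⊗ 1` on the complement of `A`, for some operator `M` on the qudits in `A`. -/
def SupportedOn (A : Finset Λ) (O : QOp Λ S) : Prop :=
  ∃ M : Matrix (A → S) (A → S) ℂ,
    O = Matrix.toEuclideanCLM (n := Λ → S) (𝕜 := ℂ)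
      (Matrix.of fun z z' =>
        if ∀ i, i ∉ A → z i = z' i then M (fun i => z i) (fun i => z' i) else 0)

/-- `κ`-local operators: linear combinations of operators supported on at most `κ` sites. -/
def IsLocal (κ : ℕ) (O : QOp Λ S) : Prop :=
  O ∈ Submodule.span ℂ {T : QOp Λ S | ∃ A : Finset Λ, A.card ≤ κ ∧ SupportedOn A T}

/-- `O` acts on site `i`, i.e. it is not of the form `1_i ⊗ O'`. -/
def ActsOn (O : QOp Λ S) (i : Λ) : Prop := ¬ SupportedOn (Finset.univ.erase i) O

/-- A bottleneck indicator is given by a finite set `B` of checks; `excOp C B` is the operator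
`E_B` that counts the excited checks of `B`.  The number `L_B` is `B.card`. -/
def excOp (C : ι → QOp Λ S) (B : Finset ι) : QOp Λ S := ∑ c ∈ B, C c

/-- The range of `Q_{B,n}`: the subspace `E_B = n`. -/
def levelSpace (C : ι → QOp Λ S) (B : Finset ι) (n : ℕ) : Submodule ℂ (QSpace Λ S) :=
  Module.End.eigenspace (excOp C B : QSpace Λ S →ₗ[ℂ] QSpace Λ S) (n : ℂ)

/-- The range of `Q_{B,≥x}`: the subspace `E_B ≥ x`. -/
def levelSpaceGE (C : ι → QOp Λ S) (B : Finset ι) (x : ℝ) : Submodule ℂ (QSpace Λ S) :=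
  ⨆ n : ℕ, ⨆ _ : x ≤ (n : ℝ), levelSpace C B n

/-- The indicator operator of `B`: the orthogonal projection onto the states in which all checks
of `B` are excited. -/
def indicatorOp (C : ι → QOp Λ S) (B : Finset ι) : QOp Λ S :=
  (⨅ c ∈ B, Module.End.eigenspace (C c : QSpace Λ S →ₗ[ℂ] QSpace Λ S) (1 : ℂ)).starProjection

/-- The indicators in `𝓑` detect the subspace `U`: some orthonormal basis of `U` consists of states
each of which is fixed by at least one indicator. -/
def Detects (C : ι → QOp Λ S) (𝓑 : Finset (Finset ι)) (U : Submodule ℂ (QSpace Λ S)) : Prop :=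
  ∃ b : Set (QSpace Λ S), Orthonormal ℂ ((↑) : b → QSpace Λ S) ∧ Submodule.span ℂ b = U ∧
    ∀ ψ ∈ b, ∃ B ∈ 𝓑, indicatorOp C B ψ = ψ

/-- Energy expectation `⟨ψ|H|ψ⟩`. -/
def expectation (H : QOp Λ S) (ψ : QSpace Λ S) : ℝ := (⟪ψ, H ψ⟫_ℂ).re

/-- Lowest energy of `H` in the subspace `P`. -/
def minEnergy (H : QOp Λ S) (P : Submodule ℂ (QSpace Λ S)) : ℝ :=
  sInf (expectation H '' {ψ | ψ ∈ P ∧ ‖ψ‖ = 1})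

/-! ## Quantum bottleneck structures and the (global) quantum Peierls condition -/

/-- `(W_k, Φ_k, 𝓑_k)_k` together with `R` is a quantum bottleneck structure, with respect to the
checks `C`, each acting on at most `g` sites and with at most `g` of them acting on each site. -/
structure IsQuantumBottleneck {K : ℕ} (g R : ℕ) (C : ι → QOp Λ S)
    (W Φ : Fin K → Submodule ℂ (QSpace Λ S)) (𝓑 : Fin K → Finset (Finset ι)) : Prop where
  one_le : 1 ≤ R
  check_proj : ∀ c, IsStarProjection (C c)
  check_comm : ∀ c c', Commute (C c) (C c')
  check_sites : ∀ c, {i : Λ | ActsOn (C c) i}.ncard ≤ g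
  site_checks : ∀ i : Λ, {c : ι | ActsOn (C c) i}.Finite ∧ {c : ι | ActsOn (C c) i}.ncard ≤ g
  wells_disconnected : ∀ k k', k ≠ k' → ∀ O : QOp Λ S, IsLocal R O →
    (W k').starProjection * O * (W k).starProjection = 0
  ortho : ∀ k, W k ⟂ Φ k
  bottleneck : ∀ k, ∀ O : QOp Λ S, IsLocal R O → ∀ ψ ∈ W k, O ψ ∈ W k ⊔ Φ k
  indicator_maps : ∀ k, ∀ B ∈ 𝓑 k, ∀ ψ ∈ Φ k, indicatorOp C B ψ ∈ Φ k
  detects : ∀ k, Detects C (𝓑 k) (Φ k)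
  level_maps : ∀ k, ∀ B ∈ 𝓑 k, ∀ n : ℕ, ∀ ψ ∈ W k ⊔ Φ k,
    (levelSpace C B n).starProjection ψ ∈ W k ⊔ Φ k

/-- The `(Δ, θ, L, R)`-quantum Peierls condition for `H` with a quantum bottleneck structure. -/
structure IsQPC {K : ℕ} (g R : ℕ) (C : ι → QOp Λ S) (H : QOp Λ S) (Δ θ L : ℝ)
    (W Φ : Fin K → Submodule ℂ (QSpace Λ S)) (𝓑 : Fin K → Finset (Finset ι)) : Prop where
  structure_ok : IsQuantumBottleneck g R C W Φ 𝓑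
  selfAdjoint : IsSelfAdjoint H
  no_bypass : ∀ k, (1 - (W k ⊔ Φ k).starProjection) * H * (W k).starProjection = 0
  card_le : ∀ k, ((𝓑 k).card : ℝ) ≤ Real.exp (θ * L)
  size_ge : ∀ k, ∀ B ∈ 𝓑 k, L ≤ (B.card : ℝ)
  energy : ∀ k, ∀ B ∈ 𝓑 k, ∀ ψ ∈ W k ⊔ Φ k, ‖ψ‖ = 1 →
    ψ ∈ levelSpaceGE C B (4 / 5 * (B.card : ℝ)) →
      Δ * (B.card : ℝ) + minEnergy H (W k ⊔ Φ k) ≤ expectation H ψ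

/-- The `(Δ, θ, L, R)`-global quantum Peierls condition: the subspaces `P_k = W_k + Φ_k` are
mutually orthogonal and not connected by `H`, and the complement of all of them is detected by a
further family `𝓑out` of indicators. -/
structure IsGlobalQPC {K : ℕ} (g R : ℕ) (C : ι → QOp Λ S) (H : QOp Λ S) (Δ θ L : ℝ)
    (W Φ : Fin K → Submodule ℂ (QSpace Λ S)) (𝓑 : Fin K → Finset (Finset ι))
    (𝓑out : Finset (Finset ι)) : Prop where
  qpc : IsQPC g R C H Δ θ L W Φ 𝓑
  disjoint : ∀ k k', k ≠ k' →
    (W k ⊔ Φ k).starProjection * (W k' ⊔ Φ k').starProjection = 0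
  disconnected : ∀ k k', k ≠ k' →
    (W k ⊔ Φ k).starProjection * H * (W k' ⊔ Φ k').starProjection = 0
  detects_out : Detects C 𝓑out (⨆ k, (W k ⊔ Φ k))ᗮ
  energy_out : ∀ B ∈ 𝓑out, ∀ ψ : QSpace Λ S, ‖ψ‖ = 1 →
    ψ ∈ levelSpaceGE C B (4 / 5 * (B.card : ℝ)) →
      Δ * (B.card : ℝ) + minEnergy H ⊤ ≤ expectation H ψ
  size_out : ∀ B ∈ 𝓑out, L ≤ (B.card : ℝ)
  card_out : ∀ m : ℕ,
    ((𝓑out.filter fun B => B.card = m).card : ℝ) ≤ Real.exp (θ * (m : ℝ))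

end Operators

/-! ## Classical spin systems with the global spin-flip symmetry

Spins take values in `ℤˣ = {1, -1}`; the on-site symmetry group is `{1, -1}`, acting by
multiplication. -/

section Spins

variable {Λ ι : Type} [Fintype Λ] [DecidableEq Λ]

/-- The truncated spin flip: flip the spins in `A`. -/
def flipOn (A : Finset Λ) (z : Λ → ℤˣ) : Λ → ℤˣ := fun i => if i ∈ A then -z i else z i

/-- All checks of `B` are excited in the configuration `z`. -/
def AllExcited (chk : ι → (Λ → ℤˣ) → ℝ) (B : Finset ι) (z : Λ → ℤˣ) : Prop :=
  ∀ c ∈ B, chk c z = 1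

/-- A bottleneck structure of sets of configurations, symmetric under the global spin flip, whose
indicators are given by sets of symmetric checks `chk c : Ω → {0, 1}`. -/
structure IsSymmetricBottleneck {K : ℕ} (R : ℕ) (chk : ι → (Λ → ℤˣ) → ℝ)
    (W Φ : Fin K → Set (Λ → ℤˣ)) (𝓑 : Fin K → Finset (Finset ι)) : Prop where
  one_le : 1 ≤ R
  wells_disconnected : ∀ k k', k ≠ k' → ∀ z ∈ W k, ∀ z' ∈ W k', R < hammingDist z z'
  disjoint : ∀ k, Disjoint (W k) (Φ k)
  bottleneck : ∀ k, ∀ z ∈ W k, ∀ z', hammingDist z z' ≤ R → z' ∈ W k ∪ Φ k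
  detects : ∀ k, ∀ z ∈ Φ k, ∃ B ∈ 𝓑 k, AllExcited chk B z
  symmetric : ∀ k k', ∃ s : ℤˣ,
    W k = (fun z i => s * z i) '' W k' ∧ Φ k = (fun z i => s * z i) '' Φ k'
  check_values : ∀ c z, chk c z = 0 ∨ chk c z = 1
  check_symmetric : ∀ c, ∀ s : ℤˣ, ∀ z, chk c (fun i => s * z i) = chk c z

/-- The strengthened energy condition for the indicator `B` and the truncated flip of `A`:
flipping `A` lowers the energy by at least `Δ L_B` in every configuration in which at least
`(4/5) L_B` of the checks of `B` are excited, and at most `c L_B` sites of `A` are joined by an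
edge of `G` to a site outside `A`. -/
def StrongEnergyCondition (G : SimpleGraph Λ) (chk : ι → (Λ → ℤˣ) → ℝ)
    (H₀ : (Λ → ℤˣ) → ℝ) (Δ c : ℝ) (B : Finset ι) (A : Finset Λ) : Prop :=
  (∀ z, 4 / 5 * (B.card : ℝ) ≤ ∑ e ∈ B, chk e z → Δ * (B.card : ℝ) + H₀ (flipOn A z) ≤ H₀ z) ∧
    (({i | i ∈ A ∧ ∃ j, j ∉ A ∧ G.Adj i j} : Set Λ).ncard : ℝ) ≤ c * (B.card : ℝ)

/-! ## The Ising model -/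

/-- The check of an edge `{i, j}`: `(1 - z_i z_j) / 2`, which is `1` if there is a domain wall
between `i` and `j`, and `0` otherwise. -/
def dwCheck (G : SimpleGraph Λ) (e : G.edgeSet) (z : Λ → ℤˣ) : ℝ :=
  Sym2.lift ⟨fun i j => (1 - ((z i : ℤ) : ℝ) * ((z j : ℤ) : ℝ)) / 2,
    fun i j => by simp only [mul_comm]⟩ (e : Sym2 Λ)

/-- The Ising Hamiltonian with uniform coupling `J` on the graph `G`. -/
def isingEnergy (G : SimpleGraph Λ) [Fintype G.edgeSet] (J : ℝ) (z : Λ → ℤˣ) : ℝ :=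
  ∑ e : G.edgeSet, J * dwCheck G e z

/-- The Pauli operator `Z_i`. -/
def pauliZ (i : Λ) : QOp Λ ℤˣ := diagOp fun z => ((z i : ℤ) : ℝ)

/-- The order parameter `A = |Λ|⁻¹ ∑ Z_i`. -/
def magnetization (Λ : Type) [Fintype Λ] [DecidableEq Λ] : QOp Λ ℤˣ :=
  ((Fintype.card Λ : ℂ)⁻¹) • ∑ i : Λ, pauliZ i

/-- The `n × n` square lattice with periodic boundary conditions (for `n ≥ 3`): the Cartesian
product of two cycles of length `n`. -/
def torus (n : ℕ) : SimpleGraph (Fin n × Fin n) :=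
  SimpleGraph.boxProd (SimpleGraph.cycleGraph n) (SimpleGraph.cycleGraph n)

instance torusEdgeFintype (n : ℕ) : Fintype (torus n).edgeSet := Fintype.ofFinite _

end Spins

end Peierls

end

/-!
The proof is a Peierls argument on the torus in which every object is read off from the set
`domainWall z` of excited edges of a configuration. Call two edges adjacent if they lie in a common
elementary square, and let `reach _ D X` be the union of the connected components of `D` that
contain an element of `X`. The role of `X` is played by the sets `cross r`, which consist of the
edges of row `r` and the vertical edges of column `0` and have at most `3 n` elements.

*Phases.* The set `P_k` consists of the configurations of sign `±` in which, for each `r`, the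
components of the domain wall that meet `cross r` have fewer than `n / 4` edges in total
(`FewWalls 4`). The well `W_k` is given by the same condition with `n / 4` replaced by
`n / (400 R)`. Flipping `R` spins adds at most `4 R` edges to the domain wall, each of which merges
boundedly many components, so the well is separated from the complement of `P_k`
(`FewWalls.of_hammingDist_le`).

*Walls are boundaries.* A union of components of a domain wall is a closed `ℤ/2`-cochain. If it
avoids a row and a column, it has no winding around the torus, and therefore bounds a region
(`exists_domainWall_eq`). This applies to the components that do *not* meet `cross r`, and hence
their complement `reach _ (domainWall z) (cross r)` always bounds a region as well
(`exists_domainWall_eq_reach`). It also applies to each union of components with fewer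
than `n` edges, and then the region has at most as many rows and columns as the wall has edges.

*Detection.* If `z` violates the condition defining `W_k` or `P_k` for the row `r`, the indicator
`B = reach _ (domainWall z) (cross r)` is excited in `z` and has at least `n / (400 R)`,
respectively `n / 4`, edges.

*Entropy.* The sets `B` whose components all meet a given `X` are exponentially few, by a
percolation argument: the events that a uniformly random edge set has `B` as the union of
its components meeting `X` are disjoint and not too unlikely (`card_rooted_le`).

*Energy.* Flipping the region bounded by `B` exchanges excited and unexcited checks of `B`. With
`4 / 5` of them excited, this gains `(2 * 4 / 5 - 1) J = 0.6 J` per edge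
(`strongEnergyCondition_domainWall`).

*Magnetization.* In `P_k`, flipping the region bounded by the walls that meet `cross r` makes row
`r` and column `0` constant, while it changes fewer than `n / 4` spins in each of them. Hence each
row agrees up to fewer than `n / 4` spins with the majority of column `0`
(`FewWalls.magnetized`). Flipping a region bounded by an indicator of `P_k` only removes domain
walls and flips fewer than `n ^ 2 / 16` spins, so it cannot leave `P_k`.

All operators are diagonal, so the statements on subspaces follow from those on configurations
(`isGlobalQPC_of_classical`).
-/

set_option linter.unusedSectionVars false

namespace Peierls

/-! ### Diagonal operators and coordinate subspaces -/

section Diagonal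

variable {Λ S ι : Type} [Fintype Λ] [DecidableEq Λ] [Fintype S] [DecidableEq S]

theorem diagOp_apply (f : (Λ → S) → ℝ) (ψ : QSpace Λ S) (z : Λ → S) :
    diagOp f ψ z = (f z : ℂ) * ψ z := by
  have h := congrFun (Matrix.ofLp_toEuclideanCLM (𝕜 := ℂ)
    (Matrix.diagonal fun z : Λ → S => (f z : ℂ)) ψ) z
  rw [Matrix.mulVec_diagonal] at h
  exact h

theorem ket_apply (z w : Λ → S) : (ket z : QSpace Λ S) w = if w = z then 1 else 0 := by
  simp [ket, PiLp.single_apply]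

theorem mem_spanKets {X : Set (Λ → S)} {ψ : QSpace Λ S} :
    ψ ∈ spanKets X ↔ ∀ z, z ∉ X → ψ z = 0 := by
  constructor
  · intro h z hz
    induction h using Submodule.span_induction with
    | mem x hx =>
      obtain ⟨w, hw, rfl⟩ := hx
      rw [ket_apply, if_neg]
      rintro rfl
      exact hz hw
    | zero => rfl
    | add x y _ _ hx hy => simp [hx, hy]
    | smul a x _ hx => simp [hx]
  · intro h
    have hψ : ψ = ∑ z, ψ z • (ket z : QSpace Λ S) := by
      ext w
      simp [ket_apply]
    rw [hψ]
    refine Submodule.sum_mem _ fun z _ => ?_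
    by_cases hz : z ∈ X
    · exact Submodule.smul_mem _ _ (Submodule.subset_span ⟨z, hz, rfl⟩)
    · rw [h z hz, zero_smul]
      exact Submodule.zero_mem _

theorem ket_mem_spanKets {X : Set (Λ → S)} {z : Λ → S} (hz : z ∈ X) :
    (ket z : QSpace Λ S) ∈ spanKets X :=
  Submodule.subset_span ⟨z, hz, rfl⟩

theorem norm_ket (z : Λ → S) : ‖(ket z : QSpace Λ S)‖ = 1 := by
  simp [ket]

theorem spanKets_union (X Y : Set (Λ → S)) : spanKets X ⊔ spanKets Y = spanKets (X ∪ Y) := by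
  rw [spanKets, spanKets, spanKets, Set.image_union, Submodule.span_union]

theorem spanKets_iUnion {κ : Type} (X : κ → Set (Λ → S)) :
    ⨆ k, spanKets (X k) = spanKets (⋃ k, X k) := by
  simp only [spanKets, Set.image_iUnion, Submodule.span_iUnion]

theorem inner_eq_sum (ψ φ : QSpace Λ S) : ⟪ψ, φ⟫_ℂ = ∑ z, φ z * star (ψ z) := by
  simp [PiLp.inner_apply]

theorem spanKets_isOrtho {X Y : Set (Λ → S)} (h : Disjoint X Y) : spanKets X ⟂ spanKets Y := by
  rw [Submodule.isOrtho_iff_inner_eq]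
  intro u hu v hv
  rw [inner_eq_sum]
  refine Finset.sum_eq_zero fun z _ => ?_
  by_cases hz : z ∈ X
  · rw [mem_spanKets.1 hv z (Set.disjoint_left.1 h hz), zero_mul]
  · rw [mem_spanKets.1 hu z hz, star_zero, mul_zero]

theorem spanKets_orthogonal (X : Set (Λ → S)) : (spanKets X)ᗮ = spanKets Xᶜ := by
  refine le_antisymm (fun ψ hψ => ?_) ?_
  · rw [mem_spanKets]
    intro z hz
    have := (Submodule.mem_orthogonal _ _).1 hψ _ (ket_mem_spanKets (not_not.1 hz))
    simpa [inner_eq_sum, ket_apply] using this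
  · rw [← Submodule.isOrtho_iff_le]
    exact spanKets_isOrtho disjoint_compl_left

open Classical in
theorem starProjection_spanKets_apply (X : Set (Λ → S)) (ψ : QSpace Λ S) (z : Λ → S) :
    (spanKets X).starProjection ψ z = if z ∈ X then ψ z else 0 := by
  have h : (spanKets X).starProjection ψ = WithLp.toLp 2 fun z => if z ∈ X then ψ z else 0 := by
    refine Submodule.eq_starProjection_of_mem_orthogonal ?_ ?_
    · rw [mem_spanKets]
      intro z hz
      simp [hz]
    · rw [spanKets_orthogonal, mem_spanKets]
      intro z hz
      simp [not_not.1 hz]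
  rw [h]

theorem starProjection_spanKets_mem {X Y : Set (Λ → S)} {ψ : QSpace Λ S}
    (hψ : ψ ∈ spanKets Y) : (spanKets X).starProjection ψ ∈ spanKets Y := by
  classical
  rw [mem_spanKets] at hψ ⊢
  intro z hz
  rw [starProjection_spanKets_apply, hψ z hz, ite_self]

theorem eigenspace_diagOp (f : (Λ → S) → ℝ) (x : ℝ) :
    Module.End.eigenspace (diagOp f : QSpace Λ S →ₗ[ℂ] QSpace Λ S) (x : ℂ) =
      spanKets {z | f z = x} := by
  ext ψ
  rw [Module.End.mem_eigenspace_iff, mem_spanKets]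
  constructor
  · intro h z hz
    have h1 : diagOp f ψ z = (x : ℂ) * ψ z := congrArg (fun φ : QSpace Λ S => φ z) h
    rw [diagOp_apply] at h1
    by_contra h0
    exact hz (Complex.ofReal_injective (mul_right_cancel₀ h0 h1))
  · intro h
    ext z
    change diagOp f ψ z = (x : ℂ) * ψ z
    rw [diagOp_apply]
    by_cases hz : f z = x
    · rw [hz]
    · rw [h z hz, mul_zero, mul_zero]

theorem excOp_diagOp (chk : ι → (Λ → S) → ℝ) (B : Finset ι) :
    excOp (fun c => diagOp (chk c)) B = diagOp fun z => ∑ c ∈ B, chk c z := by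
  ext ψ z
  simp [excOp, diagOp_apply, Finset.sum_mul]

theorem levelSpace_diagOp (chk : ι → (Λ → S) → ℝ) (B : Finset ι) (n : ℕ) :
    levelSpace (fun c => diagOp (chk c)) B n = spanKets {z | ∑ c ∈ B, chk c z = n} := by
  rw [levelSpace, excOp_diagOp]
  exact_mod_cast eigenspace_diagOp (fun z => ∑ c ∈ B, chk c z) n

theorem levelSpaceGE_diagOp_le (chk : ι → (Λ → S) → ℝ) (B : Finset ι) (x : ℝ) :
    levelSpaceGE (fun c => diagOp (chk c)) B x ≤ spanKets {z | x ≤ ∑ c ∈ B, chk c z} := by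
  refine iSup₂_le fun n hn => ?_
  rw [levelSpace_diagOp]
  refine Submodule.span_mono (Set.image_mono fun z hz => ?_)
  rw [Set.mem_ofPred_eq] at hz ⊢
  rwa [hz]

theorem indicatorOp_diagOp (chk : ι → (Λ → S) → ℝ) (B : Finset ι) :
    indicatorOp (fun c => diagOp (chk c)) B =
      (spanKets {z : Λ → S | ∀ c ∈ B, chk c z = 1}).starProjection := by
  have h : (⨅ c ∈ B, Module.End.eigenspace
      (diagOp (chk c) : QSpace Λ S →ₗ[ℂ] QSpace Λ S) (1 : ℂ)) =
      spanKets {z : Λ → S | ∀ c ∈ B, chk c z = 1} := by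
    have h1 : ∀ c, Module.End.eigenspace
        (diagOp (chk c) : QSpace Λ S →ₗ[ℂ] QSpace Λ S) (1 : ℂ) = spanKets {z | chk c z = 1} := by
      intro c
      exact_mod_cast eigenspace_diagOp (chk c) 1
    simp only [h1]
    ext ψ
    simp only [Submodule.mem_iInf, mem_spanKets, Set.mem_ofPred_eq]
    constructor
    · intro h z hz
      push Not at hz
      obtain ⟨c, hc, hz⟩ := hz
      exact h c hc z hz
    · intro h c hc z hz
      exact h z fun h => hz (h c hc)
  simp only [indicatorOp, h]

theorem detects_spanKets {chk : ι → (Λ → S) → ℝ} {𝓑 : Finset (Finset ι)} {X : Set (Λ → S)}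
    (h : ∀ z ∈ X, ∃ B ∈ 𝓑, ∀ c ∈ B, chk c z = 1) :
    Detects (fun c => diagOp (chk c)) 𝓑 (spanKets X) := by
  refine ⟨ket '' X, ?_, rfl, ?_⟩
  · have : Orthonormal ℂ (ket : (Λ → S) → QSpace Λ S) := by
      rw [orthonormal_iff_ite]
      intro z w
      simp [inner_eq_sum, ket_apply, eq_comm]
    have h2 := (this.comp (Subtype.val : X → _) Subtype.val_injective).toSubtypeRange
    rw [Set.range_comp, Subtype.range_coe] at h2
    exact h2
  · rintro _ ⟨z, hz, rfl⟩
    obtain ⟨B, hB, hc⟩ := h z hz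
    refine ⟨B, hB, ?_⟩
    rw [indicatorOp_diagOp, Submodule.starProjection_eq_self_iff]
    exact ket_mem_spanKets hc

theorem isStarProjection_diagOp {f : (Λ → S) → ℝ} (hf : ∀ z, f z = 0 ∨ f z = 1) :
    IsStarProjection (diagOp f : QOp Λ S) := by
  classical
  have h : diagOp f = (spanKets {z | f z = 1}).starProjection := by
    ext ψ z
    rw [diagOp_apply, starProjection_spanKets_apply]
    rcases hf z with h | h <;> simp [h]
  rw [h]
  exact isStarProjection_starProjection

theorem commute_diagOp (f g : (Λ → S) → ℝ) : Commute (diagOp f : QOp Λ S) (diagOp g) := by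
  ext ψ z
  change diagOp f (diagOp g ψ) z = diagOp g (diagOp f ψ) z
  simp only [diagOp_apply]
  ring

theorem isSelfAdjoint_diagOp (f : (Λ → S) → ℝ) : IsSelfAdjoint (diagOp f : QOp Λ S) := by
  rw [ContinuousLinearMap.isSelfAdjoint_iff_isSymmetric]
  intro ψ φ
  change ⟪diagOp f ψ, φ⟫_ℂ = ⟪ψ, diagOp f φ⟫_ℂ
  rw [inner_eq_sum, inner_eq_sum]
  refine Finset.sum_congr rfl fun z _ => ?_
  rw [diagOp_apply, diagOp_apply]
  simp
  ring

theorem expectation_diagOp (f : (Λ → S) → ℝ) (ψ : QSpace Λ S) :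
    expectation (diagOp f) ψ = ∑ z, f z * ‖ψ z‖ ^ 2 := by
  rw [expectation, inner_eq_sum, Complex.re_sum]
  refine Finset.sum_congr rfl fun z _ => ?_
  rw [diagOp_apply, mul_assoc, Complex.re_ofReal_mul, ← Complex.normSq_eq_norm_sq,
    Complex.star_def, Complex.mul_conj, Complex.ofReal_re]

theorem norm_sq_eq_sum (ψ : QSpace Λ S) : ‖ψ‖ ^ 2 = ∑ z, ‖ψ z‖ ^ 2 :=
  EuclideanSpace.norm_sq_eq ψ

theorem le_expectation_diagOp {f : (Λ → S) → ℝ} {X : Set (Λ → S)} {a : ℝ}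
    (h : ∀ z ∈ X, a ≤ f z) {ψ : QSpace Λ S} (hψ : ψ ∈ spanKets X) :
    a * ‖ψ‖ ^ 2 ≤ expectation (diagOp f) ψ := by
  rw [expectation_diagOp, norm_sq_eq_sum, Finset.mul_sum]
  refine Finset.sum_le_sum fun z _ => ?_
  by_cases hz : z ∈ X
  · exact mul_le_mul_of_nonneg_right (h z hz) (by positivity)
  · simp [mem_spanKets.1 hψ z hz]

theorem lt_expectation_diagOp {f : (Λ → S) → ℝ} {X : Set (Λ → S)} {a : ℝ}
    (h : ∀ z ∈ X, a < f z) {ψ : QSpace Λ S} (hψ : ψ ∈ spanKets X) (h0 : ψ ≠ 0) :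
    a * ‖ψ‖ ^ 2 < expectation (diagOp f) ψ := by
  rw [expectation_diagOp, norm_sq_eq_sum, Finset.mul_sum]
  refine Finset.sum_lt_sum (fun z _ => ?_) ?_
  · by_cases hz : z ∈ X
    · exact mul_le_mul_of_nonneg_right (h z hz).le (by positivity)
    · simp [mem_spanKets.1 hψ z hz]
  · obtain ⟨z, hz⟩ : ∃ z, ψ z ≠ 0 := by
      by_contra! hz
      exact h0 (by ext z; simpa using hz z)
    refine ⟨z, Finset.mem_univ _, ?_⟩
    have hX : z ∈ X := by
      by_contra hX
      exact hz (mem_spanKets.1 hψ z hX)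
    have : 0 < ‖ψ z‖ := norm_pos_iff.2 hz
    exact mul_lt_mul_of_pos_right (h z hX) (by positivity)

theorem expectation_diagOp_neg (f : (Λ → S) → ℝ) (ψ : QSpace Λ S) :
    expectation (diagOp fun z => -f z) ψ = -expectation (diagOp f) ψ := by
  simp [expectation_diagOp]

theorem minEnergy_diagOp_nonpos {f : (Λ → S) → ℝ} (hf : ∀ z, 0 ≤ f z)
    {P : Submodule ℂ (QSpace Λ S)} {z₀ : Λ → S} (hz₀ : ket z₀ ∈ P) (h0 : f z₀ = 0) :
    minEnergy (diagOp f) P ≤ 0 := by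
  -- the energies are bounded below, so the infimum is not a junk value
  refine csInf_le ⟨0, ?_⟩ ⟨ket z₀, ⟨hz₀, norm_ket z₀⟩, ?_⟩
  · rintro _ ⟨ψ, -, rfl⟩
    rw [expectation_diagOp]
    exact Finset.sum_nonneg fun z _ => mul_nonneg (hf z) (by positivity)
  · rw [expectation_diagOp]
    refine Finset.sum_eq_zero fun z _ => ?_
    rw [ket_apply]
    split_ifs with hz
    · rw [hz, h0, zero_mul]
    · simp

theorem SupportedOn.apply_eq_zero {A : Finset Λ} {O : QOp Λ S} (h : SupportedOn A O)
    {z w : Λ → S} (hzw : ¬ ∀ i, i ∉ A → w i = z i) : O (ket z) w = 0 := by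
  obtain ⟨M, rfl⟩ := h
  have h1 := congrFun (Matrix.ofLp_toEuclideanCLM (𝕜 := ℂ) (Matrix.of fun z z' : Λ → S =>
        if ∀ i, i ∉ A → z i = z' i then M (fun i => z i) (fun i => z' i) else 0) (ket z)) w
  refine h1.trans ?_
  rw [Matrix.mulVec, dotProduct]
  refine Finset.sum_eq_zero fun u _ => ?_
  change _ * (ket z : QSpace Λ S) u = 0
  rw [ket_apply]
  split_ifs with hu
  · subst hu
    simp [hzw]
  · rw [mul_zero]

theorem IsLocal.apply_ket_eq_zero {R : ℕ} {O : QOp Λ S} (h : IsLocal R O) {z w : Λ → S}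
    (hzw : R < hammingDist z w) : O (ket z) w = 0 := by
  induction h using Submodule.span_induction with
  | mem T hT =>
    obtain ⟨A, hA, hT⟩ := hT
    refine hT.apply_eq_zero fun h => ?_
    have : hammingDist z w ≤ A.card := by
      refine Finset.card_le_card fun i hi => ?_
      by_contra hiA
      exact (Finset.mem_filter.1 hi).2 (h i hiA).symm
    omega
  | zero => rfl
  | add x y _ _ hx hy => simp [hx, hy]
  | smul a x _ hx => simp [hx]

theorem IsLocal.apply_mem_spanKets {R : ℕ} {O : QOp Λ S} (h : IsLocal R O) {X Y : Set (Λ → S)}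
    (hXY : ∀ z ∈ X, ∀ w, hammingDist z w ≤ R → w ∈ Y) {ψ : QSpace Λ S} (hψ : ψ ∈ spanKets X) :
    O ψ ∈ spanKets Y := by
  induction hψ using Submodule.span_induction with
  | mem x hx =>
    obtain ⟨z, hz, rfl⟩ := hx
    rw [mem_spanKets]
    intro w hw
    refine h.apply_ket_eq_zero ?_
    by_contra! hd
    exact hw (hXY z hz w hd)
  | zero => simp
  | add x y _ _ hx hy => rw [map_add]; exact Submodule.add_mem _ hx hy
  | smul a x _ hx => rw [map_smul]; exact Submodule.smul_mem _ _ hx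

theorem starProjection_mul_mul_eq_zero {O : QOp Λ S} {X Y : Set (Λ → S)}
    (h : ∀ ψ ∈ spanKets X, O ψ ∈ spanKets Yᶜ) :
    (spanKets Y).starProjection * O * (spanKets X).starProjection = 0 := by
  classical
  ext ψ w
  change (spanKets Y).starProjection (O ((spanKets X).starProjection ψ)) w = 0
  rw [starProjection_spanKets_apply]
  split_ifs with hw
  · exact mem_spanKets.1 (h _ (Submodule.starProjection_apply_mem _ _)) w (not_not.2 hw)
  · rfl

theorem one_sub_starProjection_mul_mul_eq_zero {O : QOp Λ S} {X Y : Set (Λ → S)}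
    (h : ∀ ψ ∈ spanKets X, O ψ ∈ spanKets Y) :
    (1 - (spanKets Y).starProjection) * O * (spanKets X).starProjection = 0 := by
  classical
  ext ψ w
  change O ((spanKets X).starProjection ψ) w -
    (spanKets Y).starProjection (O ((spanKets X).starProjection ψ)) w = 0
  rw [Submodule.starProjection_eq_self_iff.2 (h _ (Submodule.starProjection_apply_mem _ _)),
    sub_self]

theorem diagOp_mem_spanKets {f : (Λ → S) → ℝ} {X : Set (Λ → S)} {ψ : QSpace Λ S}
    (hψ : ψ ∈ spanKets X) : diagOp f ψ ∈ spanKets X := by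
  rw [mem_spanKets] at hψ ⊢
  intro z hz
  rw [diagOp_apply, hψ z hz, mul_zero]

theorem supportedOn_diagOp {f : (Λ → S) → ℝ} {A : Finset Λ}
    (h : ∀ z w : Λ → S, (∀ i ∈ A, z i = w i) → f z = f w) : SupportedOn A (diagOp f) := by
  classical
  rcases isEmpty_or_nonempty (Λ → S) with hE | ⟨⟨z₀⟩⟩
  · exact ⟨0, by ext ψ z; exact hE.elim z⟩
  refine ⟨Matrix.diagonal fun u => (f fun i => if hi : i ∈ A then u ⟨i, hi⟩ else z₀ i : ℂ), ?_⟩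
  rw [diagOp]
  congr 1
  ext z w
  rw [Matrix.of_apply, Matrix.diagonal_apply, Matrix.diagonal_apply]
  by_cases hzw : z = w
  · subst hzw
    simp only [if_true, implies_true]
    congr 1
    refine h _ _ fun i hi => ?_
    simp [hi]
  · rw [if_neg hzw]
    split_ifs with h1 h2
    · refine (hzw (funext fun i => ?_)).elim
      by_cases hi : i ∈ A
      · exact congrFun h2 ⟨i, hi⟩
      · exact h1 i hi
    · rfl
    · rfl

end Diagonal

/-! ### From classical to quantum bottleneck structures -/

section Classical

variable {Λ ι : Type} [Fintype Λ] [DecidableEq Λ]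

/-- For Hamiltonians and checks that are diagonal in the computational basis, the global quantum
Peierls condition for subspaces spanned by basis vectors follows from a classical bottleneck
structure together with an energy bound for configurations. -/
theorem isGlobalQPC_of_classical {K g R : ℕ} {chk : ι → (Λ → ℤˣ) → ℝ} {f : (Λ → ℤˣ) → ℝ}
    {Δ θ L : ℝ} {W Φ : Fin K → Set (Λ → ℤˣ)} {𝓑 : Fin K → Finset (Finset ι)}
    {𝓑out : Finset (Finset ι)} (hs : IsSymmetricBottleneck R chk W Φ 𝓑)
    (hsites : ∀ c, {i : Λ | ActsOn (diagOp (chk c)) i}.ncard ≤ g)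
    (hchecks : ∀ i, {c : ι | ActsOn (diagOp (chk c)) i}.Finite ∧
      {c : ι | ActsOn (diagOp (chk c)) i}.ncard ≤ g)
    (hcard : ∀ k, ((𝓑 k).card : ℝ) ≤ Real.exp (θ * L))
    (hsize : ∀ k, ∀ B ∈ 𝓑 k, L ≤ (B.card : ℝ))
    (hf : ∀ z, 0 ≤ f z) (hground : ∀ k, ∃ z ∈ W k ∪ Φ k, f z = 0) (hground' : ∃ z, f z = 0)
    (henergy : ∀ k, ∀ B ∈ 𝓑 k, ∀ z, 4 / 5 * (B.card : ℝ) ≤ ∑ c ∈ B, chk c z →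
      Δ * (B.card : ℝ) ≤ f z)
    (hdisj : ∀ k k', k ≠ k' → Disjoint (W k ∪ Φ k) (W k' ∪ Φ k'))
    (hdet : ∀ z, (∀ k, z ∉ W k ∪ Φ k) → ∃ B ∈ 𝓑out, AllExcited chk B z)
    (henergy_out : ∀ B ∈ 𝓑out, ∀ z, 4 / 5 * (B.card : ℝ) ≤ ∑ c ∈ B, chk c z →
      Δ * (B.card : ℝ) ≤ f z)
    (hsize_out : ∀ B ∈ 𝓑out, L ≤ (B.card : ℝ))
    (hcard_out : ∀ m : ℕ,
      ((𝓑out.filter fun B => B.card = m).card : ℝ) ≤ Real.exp (θ * (m : ℝ))) :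
    IsGlobalQPC g R (fun c => diagOp (chk c)) (diagOp f) Δ θ L
      (fun k => spanKets (W k)) (fun k => spanKets (Φ k)) 𝓑 𝓑out := by
  have hE : ∀ (B : Finset ι) (P : Submodule ℂ (QSpace Λ ℤˣ)) (ψ : QSpace Λ ℤˣ),
      (∀ z, 4 / 5 * (B.card : ℝ) ≤ ∑ c ∈ B, chk c z → Δ * (B.card : ℝ) ≤ f z) →
      minEnergy (diagOp f) P ≤ 0 → ‖ψ‖ = 1 →
      ψ ∈ levelSpaceGE (fun c => diagOp (chk c)) B (4 / 5 * (B.card : ℝ)) →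
      Δ * (B.card : ℝ) + minEnergy (diagOp f) P ≤ expectation (diagOp f) ψ := by
    intro B P ψ h1 h2 h3 h4
    have h5 := le_expectation_diagOp (f := f) (a := Δ * (B.card : ℝ))
      (fun z hz => h1 z hz) (levelSpaceGE_diagOp_le chk B _ h4)
    rw [h3] at h5
    linarith
  refine ⟨⟨⟨hs.one_le, ?_, ?_, hsites, hchecks, ?_, ?_, ?_, ?_, ?_, ?_⟩, isSelfAdjoint_diagOp f,
    ?_, hcard, hsize, ?_⟩, ?_, ?_, ?_, ?_, hsize_out, hcard_out⟩
  · exact fun c => isStarProjection_diagOp (hs.check_values c)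
  · exact fun c c' => commute_diagOp _ _
  · intro k k' hk O hO
    refine starProjection_mul_mul_eq_zero fun ψ hψ => hO.apply_mem_spanKets ?_ hψ
    intro z hz w hw hw'
    have := hs.wells_disconnected k k' hk z hz w hw'
    omega
  · exact fun k => spanKets_isOrtho (hs.disjoint k)
  · intro k O hO ψ hψ
    rw [spanKets_union]
    exact hO.apply_mem_spanKets (hs.bottleneck k) hψ
  · intro k B _ ψ hψ
    rw [indicatorOp_diagOp]
    exact starProjection_spanKets_mem hψ
  · exact fun k => detects_spanKets (hs.detects k)
  · intro k B _ n ψ hψ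
    rw [levelSpace_diagOp]
    rw [spanKets_union] at hψ ⊢
    exact starProjection_spanKets_mem hψ
  · intro k
    simp only [spanKets_union]
    refine one_sub_starProjection_mul_mul_eq_zero fun ψ hψ => diagOp_mem_spanKets ?_
    exact Submodule.span_mono (Set.image_mono Set.subset_union_left) hψ
  · intro k B hB ψ _ h1 h2
    refine hE B _ ψ (henergy k B hB) ?_ h1 h2
    obtain ⟨z, hz, h0⟩ := hground k
    rw [spanKets_union]
    exact minEnergy_diagOp_nonpos hf (ket_mem_spanKets hz) h0
  · intro k k' hk
    simp only [spanKets_union]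
    rw [← mul_one (spanKets (W k ∪ Φ k)).starProjection]
    refine starProjection_mul_mul_eq_zero fun ψ hψ => ?_
    exact Submodule.span_mono (Set.image_mono (hdisj k k' hk).subset_compl_left) hψ
  · intro k k' hk
    simp only [spanKets_union]
    refine starProjection_mul_mul_eq_zero fun ψ hψ => diagOp_mem_spanKets ?_
    exact Submodule.span_mono (Set.image_mono (hdisj k k' hk).subset_compl_left) hψ
  · simp only [spanKets_union]
    rw [spanKets_iUnion, spanKets_orthogonal]
    refine detects_spanKets fun z hz => hdet z fun k hk => hz (Set.mem_iUnion.2 ⟨k, hk⟩)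
  · intro B hB ψ h1 h2
    refine hE B _ ψ (henergy_out B hB) ?_ h1 h2
    obtain ⟨z, h0⟩ := hground'
    exact minEnergy_diagOp_nonpos hf (z₀ := z) Submodule.mem_top h0

end Classical

/-! ### Connected components and counting of connected sets -/

section Reach

variable {E : Type} [Fintype E] [DecidableEq E]

open Classical in
/-- The union of those connected components of `D` (with respect to the adjacency relation `adj`)
that contain an element of `X`. -/
noncomputable def reach (adj : E → E → Prop) (D X : Finset E) : Finset E :=
  Finset.univ.filter fun e =>
    ∃ x ∈ X, x ∈ D ∧ Relation.ReflTransGen (fun a b => adj a b ∧ b ∈ D) x e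

variable {adj : E → E → Prop} {D D' F X B : Finset E}

theorem mem_reach {e : E} : e ∈ reach adj D X ↔
    ∃ x ∈ X, x ∈ D ∧ Relation.ReflTransGen (fun a b => adj a b ∧ b ∈ D) x e := by
  simp [reach]

theorem mem_reach_of_mem {e : E} (hX : e ∈ X) (hD : e ∈ D) : e ∈ reach adj D X :=
  mem_reach.2 ⟨e, hX, hD, .refl⟩

theorem mem_reach_of_adj {e e' : E} (he : e ∈ reach adj D X) (h : adj e e') (he' : e' ∈ D) :
    e' ∈ reach adj D X := by
  obtain ⟨x, hx, hxD, hp⟩ := mem_reach.1 he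
  exact mem_reach.2 ⟨x, hx, hxD, hp.tail ⟨h, he'⟩⟩

theorem reach_induction {p : E → Prop} (hroot : ∀ x ∈ X, x ∈ D → p x)
    (hstep : ∀ a b, p a → adj a b → b ∈ D → p b) {e : E} (he : e ∈ reach adj D X) : p e := by
  obtain ⟨x, hx, hxD, hp⟩ := mem_reach.1 he
  clear he
  induction hp with
  | refl => exact hroot x hx hxD
  | tail _ h ih => exact hstep _ _ ih h.1 h.2

theorem reach_subset : reach adj D X ⊆ D := fun _ he =>
  reach_induction (p := (· ∈ D)) (fun _ _ h => h) (fun _ _ _ _ h => h) he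

theorem reach_mono (h : D ⊆ D') : reach adj D X ⊆ reach adj D' X := fun _ he =>
  reach_induction (p := (· ∈ reach adj D' X)) (fun _ hx hD => mem_reach_of_mem hx (h hD))
    (fun _ _ ha hab hb => mem_reach_of_adj ha hab (h hb)) he

theorem reach_mono_right {X' : Finset E} (h : X ⊆ X') : reach adj D X ⊆ reach adj D X' :=
  fun _ he => reach_induction (p := (· ∈ reach adj D X')) (fun _ hx hD => mem_reach_of_mem (h hx) hD)
    (fun _ _ ha hab hb => mem_reach_of_adj ha hab hb) he

/-- Every connected component of `B` contains an element of `X`. -/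
def Rooted (adj : E → E → Prop) (X B : Finset E) : Prop := B ⊆ reach adj B X

theorem rooted_reach : Rooted adj X (reach adj D X) := by
  intro e he
  refine (reach_induction (D := D) (X := X) (adj := adj)
    (p := fun e => e ∈ reach adj D X ∧ e ∈ reach adj (reach adj D X) X) ?_ ?_ he).2
  · exact fun x hx hD => ⟨mem_reach_of_mem hx hD, mem_reach_of_mem hx (mem_reach_of_mem hx hD)⟩
  · intro a b ha hab hb
    have := mem_reach_of_adj ha.1 hab hb
    exact ⟨this, mem_reach_of_adj ha.2 hab this⟩

/-- A rooted set is recovered from any superset that adds no root and no neighbour of the set. -/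
theorem Rooted.subset_of_union_eq {B' σ' : Finset E} (hB : Rooted adj X B)
    (h : B ⊆ B' ∪ σ') (hX : ∀ x ∈ X, x ∉ σ') (hn : ∀ a ∈ B', ∀ b, adj a b → b ∉ σ') :
    B ⊆ B' := by
  intro e he
  refine reach_induction (p := (· ∈ B')) (fun x hx hxB => ?_) (fun a b ha hab hb => ?_) (hB he)
  · exact (Finset.mem_union.1 (h hxB)).resolve_right (hX x hx)
  · exact (Finset.mem_union.1 (h hb)).resolve_right (hn a ha b hab)

open Classical in
/-- There are at most `2 ^ M` sets `B`, each of whose components contains an element of `X`, such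
that `X`, `B` and the neighbours of `B` make up at most `M` elements. If a subset of `E` is drawn
uniformly at random, the events that the components meeting `X` have union `B` are disjoint for
different `B`, and each of them has probability at least `2 ^ (-M)`. -/
theorem card_rooted_le (nbr : E → Finset E) (hnbr : ∀ a b, adj a b → b ∈ nbr a) (M : ℕ) :
    (Finset.univ.filter fun B : Finset E =>
      Rooted adj X B ∧ (X ∪ B ∪ B.biUnion nbr).card ≤ M).card ≤ 2 ^ M := by
  set 𝒮 := Finset.univ.filter fun B : Finset E =>
    Rooted adj X B ∧ (X ∪ B ∪ B.biUnion nbr).card ≤ M with h𝒮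
  set N := Fintype.card E
  -- The pairs `(B, σ)` with `σ` avoiding `X`, `B` and the neighbours of `B` inject into the subsets
  -- of `E` by `(B, σ) ↦ B ∪ σ`, as `B` is the union of the components of `B ∪ σ` that meet `X`.
  have h1 : (𝒮.sigma fun B => (X ∪ B ∪ B.biUnion nbr)ᶜ.powerset).card ≤ 2 ^ N := by
    rw [← Fintype.card_finset, ← Finset.card_univ]
    refine Finset.card_le_card_of_injOn (fun p => p.1 ∪ p.2) (fun _ _ => Finset.mem_univ _) ?_
    rintro ⟨B, σ⟩ hp ⟨B', σ'⟩ hp' h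
    simp only [h𝒮, Finset.coe_sigma, Set.mem_sigma_iff, Finset.mem_coe, Finset.mem_filter,
      Finset.mem_univ, true_and, Finset.mem_powerset] at hp hp' h
    have key : ∀ {B σ : Finset E}, σ ⊆ (X ∪ B ∪ B.biUnion nbr)ᶜ →
        (∀ x ∈ X, x ∉ σ) ∧ (∀ x ∈ B, x ∉ σ) ∧ ∀ a ∈ B, ∀ b, adj a b → b ∉ σ := by
      intro B σ hσ
      refine ⟨fun x hx hxσ => ?_, fun x hx hxσ => ?_, fun a ha b hab hb => ?_⟩
      · simpa [hx] using hσ hxσ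
      · simpa [hx] using hσ hxσ
      · have h2 := hσ hb
        simp only [Finset.mem_compl, Finset.mem_union, Finset.mem_biUnion, not_or, not_exists,
          not_and] at h2
        exact h2.2 a ha (hnbr a b hab)
    obtain ⟨k1, k2, k3⟩ := key hp.2
    obtain ⟨k1', k2', k3'⟩ := key hp'.2
    have hB : B = B' := by
      refine Finset.Subset.antisymm ?_ ?_
      · exact hp.1.1.subset_of_union_eq (h ▸ Finset.subset_union_left) k1' k3'
      · exact hp'.1.1.subset_of_union_eq (h ▸ Finset.subset_union_left) k1 k3
    subst hB
    have hσ : σ = σ' := by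
      ext x
      have hx := Finset.ext_iff.1 h x
      simp only [Finset.mem_union] at hx
      constructor
      · exact fun hs => (hx.1 (Or.inr hs)).resolve_left fun hxB => k2 x hxB hs
      · exact fun hs => (hx.2 (Or.inr hs)).resolve_left fun hxB => k2' x hxB hs
    rw [hσ]
  rw [Finset.card_sigma] at h1
  have h2 : 𝒮.card * 2 ^ (N - M) ≤ 2 ^ N := by
    refine le_trans ?_ h1
    rw [← smul_eq_mul]
    refine Finset.card_nsmul_le_sum _ _ _ fun B hB => ?_
    rw [Finset.card_powerset, Finset.card_compl]
    have := (Finset.mem_filter.1 hB).2.2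
    exact Nat.pow_le_pow_right (by norm_num) (by omega)
  have h3 : (2 : ℕ) ^ N ≤ 2 ^ M * 2 ^ (N - M) := by
    rw [← pow_add]
    exact Nat.pow_le_pow_right (by norm_num) (by omega)
  exact Nat.le_of_mul_le_mul_right (h2.trans h3) (by positivity)

theorem card_closedNbr_le {nbr : E → Finset E} {d : ℕ} (hd : ∀ a, (nbr a).card ≤ d) :
    (X ∪ B ∪ B.biUnion nbr).card ≤ X.card + (d + 1) * B.card := by
  have h1 : (B.biUnion nbr).card ≤ B.card * d := Finset.card_biUnion_le_card_mul _ _ _ fun a _ => hd a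
  have h2 := Finset.card_union_le (X ∪ B) (B.biUnion nbr)
  have h3 := Finset.card_union_le X B
  nlinarith

/-- Adding a set `F` to `D` enlarges `reach D X` at most by `F` and the components of `D` adjacent
to `F`. -/
theorem card_reach_union_le {nbr : E → Finset E} (hnbr : ∀ a b, adj a b → b ∈ nbr a) {d k : ℕ}
    (hd : ∀ a, (nbr a).card ≤ d) (hk : ∀ e, (reach adj D {e}).card ≤ k) :
    (reach adj (D ∪ F) X).card ≤ (reach adj D X).card + F.card * (1 + d * k) := by
  set G := F.biUnion fun f => (nbr f).biUnion fun e => reach adj D {e} with hG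
  have hsub : reach adj (D ∪ F) X ⊆ reach adj D X ∪ (F ∪ G) := by
    intro e he
    refine reach_induction (p := (· ∈ reach adj D X ∪ (F ∪ G))) ?_ ?_ he
    · intro x hx hxD
      rcases Finset.mem_union.1 hxD with h | h
      · exact Finset.mem_union_left _ (mem_reach_of_mem hx h)
      · exact Finset.mem_union_right _ (Finset.mem_union_left _ h)
    · intro a b ha hab hb
      by_cases hbF : b ∈ F
      · exact Finset.mem_union_right _ (Finset.mem_union_left _ hbF)
      have hbD := (Finset.mem_union.1 hb).resolve_right hbF
      rcases Finset.mem_union.1 ha with ha | ha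
      · exact Finset.mem_union_left _ (mem_reach_of_adj ha hab hbD)
      refine Finset.mem_union_right _ (Finset.mem_union_right _ ?_)
      rcases Finset.mem_union.1 ha with ha | ha
      · exact Finset.mem_biUnion.2 ⟨a, ha, Finset.mem_biUnion.2 ⟨b, hnbr a b hab,
          mem_reach_of_mem (Finset.mem_singleton_self b) hbD⟩⟩
      · obtain ⟨f, hf, ha⟩ := Finset.mem_biUnion.1 ha
        obtain ⟨c, hc, ha⟩ := Finset.mem_biUnion.1 ha
        exact Finset.mem_biUnion.2 ⟨f, hf, Finset.mem_biUnion.2 ⟨c, hc,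
          mem_reach_of_adj ha hab hbD⟩⟩
  have h1 : G.card ≤ F.card * (d * k) := by
    refine Finset.card_biUnion_le_card_mul _ _ _ fun f _ => ?_
    refine (Finset.card_biUnion_le_card_mul _ _ k fun e _ => hk e).trans ?_
    exact Nat.mul_le_mul_right _ (hd f)
  have h2 := Finset.card_le_card hsub
  have h3 := Finset.card_union_le (reach adj D X) (F ∪ G)
  have h4 := Finset.card_union_le F G
  nlinarith

end Reach

/-! ### Domain walls on the discrete torus -/

section Torus

/-- Labels of the edges of the discrete torus: `(false, x, y)` is the edge from `(x, y)` to
`(x + 1, y)`, and `(true, x, y)` is the edge from `(x, y)` to `(x, y + 1)`. -/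
abbrev EdgeLabel (n : ℕ) : Type := Bool × Fin n × Fin n

variable {n : ℕ} [NeZero n]

/-- The second endpoint of a labelled edge; the first one is `l.2`. -/
def tgt : EdgeLabel n → Fin n × Fin n
  | (false, x, y) => (x + 1, y)
  | (true, x, y) => (x, y + 1)

/-- The edges across which `z` changes sign. -/
def domainWall (z : Fin n × Fin n → ℤˣ) : Finset (EdgeLabel n) :=
  Finset.univ.filter fun l => z l.2 ≠ z (tgt l)

/-- The four edges of the elementary square with corner `(x, y)`. -/
def plaquette (x y : Fin n) : Finset (EdgeLabel n) :=
  {(false, x, y), (false, x, y + 1), (true, x, y), (true, x + 1, y)}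

/-- Two edges are adjacent if some elementary square contains both; on the dual lattice this
means that the dual edges share an endpoint. -/
def PlaquetteAdj (l l' : EdgeLabel n) : Prop :=
  ∃ x y, l ∈ plaquette x y ∧ l' ∈ plaquette x y

/-- The edges of the two elementary squares that contain a given edge. -/
def plaquetteNbr : EdgeLabel n → Finset (EdgeLabel n)
  | (false, x, y) => plaquette x y ∪ plaquette x (y - 1)
  | (true, x, y) => plaquette x y ∪ plaquette (x - 1) y

/-- The edges starting in row `r`, together with the vertical edges of column `0`. A set of edges
that avoids a cross has no winding around the torus. -/
def cross (r : Fin n) : Finset (EdgeLabel n) :=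
  Finset.univ.filter fun l => l.2.2 = r ∨ (l.1 = true ∧ l.2.1 = 0)

theorem mem_domainWall {z : Fin n × Fin n → ℤˣ} {l : EdgeLabel n} :
    l ∈ domainWall z ↔ z l.2 ≠ z (tgt l) := by
  simp [domainWall]

theorem PlaquetteAdj.symm {l l' : EdgeLabel n} : PlaquetteAdj l l' → PlaquetteAdj l' l :=
  fun ⟨x, y, h, h'⟩ => ⟨x, y, h', h⟩

theorem card_plaquette_le (x y : Fin n) : (plaquette x y).card ≤ 4 := Finset.card_le_four

theorem card_plaquetteNbr_le (l : EdgeLabel n) : (plaquetteNbr l).card ≤ 8 := by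
  obtain ⟨_ | _, x, y⟩ := l <;>
  · refine (Finset.card_union_le _ _).trans ?_
    exact add_le_add (card_plaquette_le _ _) (card_plaquette_le _ _)

theorem PlaquetteAdj.mem_nbr (l l' : EdgeLabel n) (h : PlaquetteAdj l l') :
    l' ∈ plaquetteNbr l := by
  obtain ⟨x, y, hl, hl'⟩ := h
  simp only [plaquette, Finset.mem_insert, Finset.mem_singleton] at hl
  rcases hl with rfl | rfl | rfl | rfl
  · exact Finset.mem_union_left _ hl'
  · exact Finset.mem_union_right _ (by rwa [add_sub_cancel_right])
  · exact Finset.mem_union_left _ hl'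
  · exact Finset.mem_union_right _ (by rwa [add_sub_cancel_right])

theorem card_cross_le (r : Fin n) : (cross r).card ≤ 3 * n := by
  have h : cross r ⊆ (Finset.univ ×ˢ (Finset.univ ×ˢ {r})) ∪
      ({true} ×ˢ ({0} ×ˢ (Finset.univ : Finset (Fin n)))) := by
    intro l hl
    obtain ⟨b, x, y⟩ := l
    simp only [cross, Finset.mem_filter, Finset.mem_univ, true_and] at hl
    simp only [Finset.mem_union, Finset.mem_product, Finset.mem_univ, Finset.mem_singleton,
      true_and, and_true]
    exact hl
  refine (Finset.card_le_card h).trans ((Finset.card_union_le _ _).trans ?_)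
  simp only [Finset.card_product, Finset.card_univ, Fintype.card_bool, Fintype.card_fin,
    Finset.card_singleton]
  omega

theorem ofNat_succ (t : ℕ) : Fin.ofNat n (t + 1) = Fin.ofNat n t + 1 := by
  apply Fin.ext
  simp [Fin.val_add]

theorem cyclic_const {α : Type*} {g : Fin n → α} (h : ∀ x, g (x + 1) = g x) (x y : Fin n) :
    g x = g y := by
  have h0 : ∀ t : ℕ, g (Fin.ofNat n t) = g (Fin.ofNat n 0) := by
    intro t
    induction t with
    | zero => rfl
    | succ t ih => rw [ofNat_succ, h, ih]
  have hx : ∀ x : Fin n, Fin.ofNat n x.val = x := fun x => Fin.ext (Nat.mod_eq_of_lt x.2)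
  rw [← hx x, ← hx y, h0, h0 y.val]

/-- A closed `1`-cochain on the torus that vanishes on a row and on a column has a potential. It is
obtained by multiplying the values along a vertical path from the given row. -/
theorem exists_potential {M : Type*} [CommGroup M] {h v : Fin n → Fin n → M}
    (hc : ∀ x y, h x y * v (x + 1) y = v x y * h x (y + 1)) {x₀ y₀ : Fin n}
    (hh : ∀ x, h x y₀ = 1) (hv : ∀ y, v x₀ y = 1) :
    ∃ f : Fin n → Fin n → M, (∀ x y, f (x + 1) y = f x y * h x y) ∧
      (∀ x y, f x (y + 1) = f x y * v x y) ∧ (∀ x, f x y₀ = 1) ∧ ∀ y, f x₀ y = 1 := by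
  set P : Fin n → ℕ → M := fun x k => ∏ t ∈ Finset.range k, v x (y₀ + Fin.ofNat n t) with hP
  have h0 : (Fin.ofNat n 0 : Fin n) = 0 := by apply Fin.ext; simp
  have hn : (Fin.ofNat n n : Fin n) = 0 := by apply Fin.ext; simp
  have hPs : ∀ x k, P x (k + 1) = P x k * v x (y₀ + Fin.ofNat n k) := fun x k =>
    Finset.prod_range_succ _ _
  have hPh : ∀ x k, P (x + 1) k = P x k * h x (y₀ + Fin.ofNat n k) := by
    intro x k
    induction k with
    | zero => simp [hP, hh]
    | succ k ih =>
      rw [hPs, hPs, ih, ofNat_succ, mul_assoc, hc, ← add_assoc, mul_assoc]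
  -- the holonomy around a column does not depend on the column
  have hPn : ∀ x, P x n = 1 := by
    intro x
    have h1 : ∀ x, P (x + 1) n = P x n := fun x => by rw [hPh, hn, add_zero, hh, mul_one]
    rw [cyclic_const (g := fun x => P x n) h1 x x₀]
    exact Finset.prod_eq_one fun t _ => hv _
  have hval : ∀ k : Fin n, ∀ x, P x (k + 1).val = P x (k.val + 1) := by
    intro k x
    have h1 : (k + 1).val = (k.val + 1) % n := by
      rw [Fin.val_add, Fin.val_one', Nat.add_mod_mod]
    rw [h1]
    rcases Nat.lt_or_ge (k.val + 1) n with h2 | h2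
    · rw [Nat.mod_eq_of_lt h2]
    · have h3 : k.val + 1 = n := le_antisymm k.2 h2
      rw [h3, Nat.mod_self, hPn]
      rfl
  have hk : ∀ k : Fin n, Fin.ofNat n k.val = k := fun k => Fin.ext (Nat.mod_eq_of_lt k.2)
  refine ⟨fun x y => P x (y - y₀).val, ?_, ?_, ?_, ?_⟩
  · intro x y
    simp only
    rw [hPh, hk, add_sub_cancel]
  · intro x y
    simp only
    rw [add_sub_right_comm, hval, hPs, hk, add_sub_cancel]
  · intro x
    simp [hP]
  · intro y
    exact Finset.prod_eq_one fun t _ => hv _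

/-- A union of connected components of a domain wall which avoids some row and some column of the
torus is the domain wall of a configuration that equals `1` on this row and this column. -/
theorem exists_domainWall_eq {z : Fin n × Fin n → ℤˣ} {γ : Finset (EdgeLabel n)}
    (hγ : γ ⊆ domainWall z)
    (hsat : ∀ a ∈ γ, ∀ b ∈ domainWall z, PlaquetteAdj a b → b ∈ γ) {x₀ y₀ : Fin n}
    (hrow : ∀ x, (false, x, y₀) ∉ γ) (hcol : ∀ y, (true, x₀, y) ∉ γ) :
    ∃ f : Fin n × Fin n → ℤˣ, domainWall f = γ ∧ (∀ x, f (x, y₀) = 1) ∧ ∀ y, f (x₀, y) = 1 := by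
  set g : EdgeLabel n → ℤˣ := fun l => if l ∈ γ then -1 else 1 with hg
  have hc : ∀ x y, g (false, x, y) * g (true, x + 1, y) =
      g (true, x, y) * g (false, x, y + 1) := by
    intro x y
    by_cases hp : ∃ a ∈ plaquette x y, a ∈ γ
    · obtain ⟨a, ha, haγ⟩ := hp
      have h1 : ∀ b ∈ plaquette x y, g b = z b.2 * z (tgt b) := by
        intro b hb
        have h2 : b ∈ γ ↔ z b.2 ≠ z (tgt b) := by
          rw [← mem_domainWall]
          exact ⟨fun h => hγ h, fun h => hsat a haγ b h ⟨x, y, ha, hb⟩⟩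
        have h3 : ∀ u v : ℤˣ, (if u ≠ v then (-1 : ℤˣ) else 1) = u * v := by decide
        rw [← h3]
        simp only [hg, h2]
      rw [h1 _ (by simp [plaquette]), h1 _ (by simp [plaquette]), h1 _ (by simp [plaquette]),
        h1 _ (by simp [plaquette])]
      have h4 : ∀ a b c d : ℤˣ, a * b * (b * c) = a * d * (d * c) := by decide
      exact h4 _ _ _ _
    · push Not at hp
      have h1 : ∀ b ∈ plaquette x y, g b = 1 := fun b hb => if_neg (hp b hb)
      rw [h1 _ (by simp [plaquette]), h1 _ (by simp [plaquette]), h1 _ (by simp [plaquette]),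
        h1 _ (by simp [plaquette])]
  obtain ⟨f, f1, f2, f3, f4⟩ := exists_potential (h := fun x y => g (false, x, y))
    (v := fun x y => g (true, x, y)) hc (fun x => if_neg (hrow x)) (fun y => if_neg (hcol y))
  refine ⟨fun i => f i.1 i.2, ?_, f3, f4⟩
  ext l
  have h1 : f (tgt l).1 (tgt l).2 = f l.2.1 l.2.2 * g l := by
    obtain ⟨_ | _, x, y⟩ := l
    · exact f1 x y
    · exact f2 x y
  rw [mem_domainWall, h1]
  by_cases hl : l ∈ γ
  · have h2 : ∀ u : ℤˣ, u ≠ u * -1 := by decide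
    simpa only [hg, hl, if_true, iff_true] using h2 _
  · simp [hg, hl]

theorem exists_row_notMem {γ : Finset (EdgeLabel n)} (h : γ.card < n) :
    ∃ y₀, ∀ l ∈ γ, l.2.2 ≠ y₀ := by
  by_contra! hc
  have h1 : (Finset.univ : Finset (Fin n)) ⊆ γ.image fun l => l.2.2 := fun y _ => by
    obtain ⟨l, hl, rfl⟩ := hc y
    exact Finset.mem_image_of_mem _ hl
  have h2 := (Finset.card_le_card h1).trans Finset.card_image_le
  rw [Finset.card_univ, Fintype.card_fin] at h2
  omega

theorem exists_column_notMem {γ : Finset (EdgeLabel n)} (h : γ.card < n) :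
    ∃ x₀, ∀ l ∈ γ, l.2.1 ≠ x₀ := by
  by_contra! hc
  have h1 : (Finset.univ : Finset (Fin n)) ⊆ γ.image fun l => l.2.1 := fun y _ => by
    obtain ⟨l, hl, rfl⟩ := hc y
    exact Finset.mem_image_of_mem _ hl
  have h2 := (Finset.card_le_card h1).trans Finset.card_image_le
  rw [Finset.card_univ, Fintype.card_fin] at h2
  omega

/-- If `f` equals `1` on a row, each column in which `f` takes another value contains an edge of
the domain wall of `f`. -/
theorem card_columns_le {f : Fin n × Fin n → ℤˣ} {y₀ : Fin n} (h : ∀ x, f (x, y₀) = 1) :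
    (Finset.univ.filter fun x => ∃ y, f (x, y) ≠ 1).card ≤ (domainWall f).card := by
  have h1 : (Finset.univ.filter fun x => ∃ y, f (x, y) ≠ 1) ⊆
      (domainWall f).image fun l => l.2.1 := by
    intro x hx
    obtain ⟨y, hy⟩ := (Finset.mem_filter.1 hx).2
    by_contra hc
    refine hy ((cyclic_const (g := fun y => f (x, y)) (fun y => ?_) y y₀).trans (h x))
    by_contra hne
    exact hc (Finset.mem_image.2 ⟨(true, x, y), mem_domainWall.2 (Ne.symm hne), rfl⟩)
  exact (Finset.card_le_card h1).trans Finset.card_image_le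

theorem card_rows_le {f : Fin n × Fin n → ℤˣ} {x₀ : Fin n} (h : ∀ y, f (x₀, y) = 1) :
    (Finset.univ.filter fun y => ∃ x, f (x, y) ≠ 1).card ≤ (domainWall f).card := by
  have h1 : (Finset.univ.filter fun y => ∃ x, f (x, y) ≠ 1) ⊆
      (domainWall f).image fun l => l.2.2 := by
    intro y hy
    obtain ⟨x, hx⟩ := (Finset.mem_filter.1 hy).2
    by_contra hc
    refine hx ((cyclic_const (g := fun x => f (x, y)) (fun x => ?_) x x₀).trans (h y))
    by_contra hne
    exact hc (Finset.mem_image.2 ⟨(false, x, y), mem_domainWall.2 (Ne.symm hne), rfl⟩)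
  exact (Finset.card_le_card h1).trans Finset.card_image_le

/-- A small union of components of a domain wall is the domain wall of a configuration whose
regions of negative spins have few columns and few rows. -/
theorem exists_small_domainWall_eq {z : Fin n × Fin n → ℤˣ} {γ : Finset (EdgeLabel n)}
    (hγ : γ ⊆ domainWall z)
    (hsat : ∀ a ∈ γ, ∀ b ∈ domainWall z, PlaquetteAdj a b → b ∈ γ) (hn : γ.card < n) :
    ∃ f : Fin n × Fin n → ℤˣ, domainWall f = γ ∧
      (Finset.univ.filter fun x => ∃ y, f (x, y) ≠ 1).card ≤ γ.card ∧
      (Finset.univ.filter fun y => ∃ x, f (x, y) ≠ 1).card ≤ γ.card := by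
  obtain ⟨y₀, hy⟩ := exists_row_notMem hn
  obtain ⟨x₀, hx⟩ := exists_column_notMem hn
  obtain ⟨f, rfl, f1, f2⟩ := exists_domainWall_eq hγ hsat (x₀ := x₀) (y₀ := y₀)
    (fun x h => hy _ h rfl) (fun y h => hx _ h rfl)
  exact ⟨f, rfl, card_columns_le f1, card_rows_le f2⟩

theorem card_neg_le (f : Fin n × Fin n → ℤˣ) :
    (Finset.univ.filter fun i => f i ≠ 1).card ≤
      (Finset.univ.filter fun x => ∃ y, f (x, y) ≠ 1).card *
      (Finset.univ.filter fun y => ∃ x, f (x, y) ≠ 1).card := by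
  rw [← Finset.card_product]
  refine Finset.card_le_card fun i hi => ?_
  have hi := (Finset.mem_filter.1 hi).2
  simp only [Finset.mem_product, Finset.mem_filter, Finset.mem_univ, true_and]
  exact ⟨⟨i.2, hi⟩, ⟨i.1, hi⟩⟩

theorem domainWall_mul (z f : Fin n × Fin n → ℤˣ) :
    domainWall (z * f) = symmDiff (domainWall z) (domainWall f) := by
  ext l
  have h : ∀ a b c d : ℤˣ, a * b ≠ c * d ↔ (a ≠ c ∧ ¬ b ≠ d) ∨ (b ≠ d ∧ ¬ a ≠ c) := by decide
  rw [Finset.mem_symmDiff, mem_domainWall, mem_domainWall, mem_domainWall]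
  exact h _ _ _ _

theorem domainWall_mul_of_subset {z f : Fin n × Fin n → ℤˣ}
    (h : domainWall f ⊆ domainWall z) : domainWall (z * f) = domainWall z \ domainWall f := by
  rw [domainWall_mul, symmDiff_def, Finset.sdiff_eq_empty_iff_subset.2 h]
  simp

theorem domainWall_const_mul (s : ℤˣ) (z : Fin n × Fin n → ℤˣ) :
    (domainWall fun i => s * z i) = domainWall z := by
  ext l
  simp [mem_domainWall]

/-- The components of a domain wall that meet a cross form the domain wall of a configuration: the
remaining components have no winding around the torus. -/
theorem exists_domainWall_eq_reach (z : Fin n × Fin n → ℤˣ) (r : Fin n) :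
    ∃ f : Fin n × Fin n → ℤˣ, domainWall f = reach PlaquetteAdj (domainWall z) (cross r) := by
  set γ := reach PlaquetteAdj (domainWall z) (cross r) with hγ
  have hcr : ∀ l ∈ cross r, l ∉ domainWall z \ γ := by
    intro l hl h
    rw [Finset.mem_sdiff] at h
    exact h.2 (mem_reach_of_mem hl h.1)
  have hsat : ∀ a ∈ domainWall z \ γ, ∀ b ∈ domainWall z, PlaquetteAdj a b →
      b ∈ domainWall z \ γ := by
    intro a ha b hb hab
    rw [Finset.mem_sdiff] at ha ⊢
    exact ⟨hb, fun hbγ => ha.2 (mem_reach_of_adj hbγ hab.symm ha.1)⟩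
  obtain ⟨f, hf, -, -⟩ := exists_domainWall_eq (x₀ := 0) (y₀ := r) Finset.sdiff_subset hsat
    (fun x => hcr _ (by simp [cross])) (fun y => hcr _ (by simp [cross]))
  refine ⟨z * f, ?_⟩
  rw [domainWall_mul_of_subset (hf ▸ Finset.sdiff_subset), hf,
    Finset.sdiff_sdiff_eq_self reach_subset]

/-- For every row, the components of the domain wall of `z` that meet the cross of this row contain
fewer than `n / q` edges in total. -/
def FewWalls (q : ℕ) (z : Fin n × Fin n → ℤˣ) : Prop :=
  ∀ r, q * (reach PlaquetteAdj (domainWall z) (cross r)).card < n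

theorem FewWalls.mono_wall {q : ℕ} {z w : Fin n × Fin n → ℤˣ} (hz : FewWalls q z)
    (h : domainWall w ⊆ domainWall z) : FewWalls q w := fun r =>
  (Nat.mul_le_mul_left q (Finset.card_le_card (reach_mono h))).trans_lt (hz r)

theorem FewWalls.mono {q q' : ℕ} {z : Fin n × Fin n → ℤˣ} (hz : FewWalls q z) (h : q' ≤ q) :
    FewWalls q' z := fun r => (Nat.mul_le_mul_right _ h).trans_lt (hz r)

/-- If the domain walls meeting the cross of row `r` are short, then most spins of row `r` have the
same sign as most spins of column `0`: flipping the spins enclosed by these walls makes both of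
them constant. -/
theorem FewWalls.row {z : Fin n × Fin n → ℤˣ} (hz : FewWalls 4 z) (r : Fin n) :
    ∃ s : ℤˣ, 4 * (Finset.univ.filter fun x => z (x, r) ≠ s).card < n ∧
      4 * (Finset.univ.filter fun y => z (0, y) ≠ s).card < n := by
  set γ := reach PlaquetteAdj (domainWall z) (cross r) with hγ
  have hr : 4 * γ.card < n := hz r
  obtain ⟨f, hf, hx, hy⟩ := exists_small_domainWall_eq (γ := γ) reach_subset
    (fun a ha b hb hab => mem_reach_of_adj ha hab hb) (by omega)
  have hcr : ∀ l ∈ cross r, l ∉ domainWall (z * f) := by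
    intro l hl h
    rw [domainWall_mul_of_subset (hf ▸ reach_subset), Finset.mem_sdiff, hf] at h
    exact h.2 (mem_reach_of_mem hl h.1)
  have hrow : ∀ x, (z * f) (x, r) = (z * f) (0, 0) := by
    intro x
    have h1 : (z * f) (x, r) = (z * f) (0, r) := by
      refine cyclic_const (g := fun x => (z * f) (x, r)) (fun x => ?_) x 0
      have := hcr (false, x, r) (by simp [cross])
      rw [mem_domainWall, not_not] at this
      exact this.symm
    rw [h1]
    refine cyclic_const (g := fun y => (z * f) (0, y)) (fun y => ?_) r 0
    have := hcr (true, 0, y) (by simp [cross])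
    rw [mem_domainWall, not_not] at this
    exact this.symm
  have hcol : ∀ y, (z * f) (0, y) = (z * f) (0, 0) := by
    intro y
    refine cyclic_const (g := fun y => (z * f) (0, y)) (fun y => ?_) y 0
    have := hcr (true, 0, y) (by simp [cross])
    rw [mem_domainWall, not_not] at this
    exact this.symm
  have hne : ∀ i, (z * f) i = (z * f) (0, 0) → z i ≠ (z * f) (0, 0) → f i ≠ 1 := by
    intro i h1 h2 h3
    rw [Pi.mul_apply, h3, mul_one] at h1
    exact h2 h1
  refine ⟨(z * f) (0, 0), ?_, ?_⟩
  · have : (Finset.univ.filter fun x => z (x, r) ≠ (z * f) (0, 0)).card ≤ γ.card := by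
      refine (Finset.card_le_card fun x hx => ?_).trans hx
      rw [Finset.mem_filter] at hx ⊢
      exact ⟨hx.1, r, hne _ (hrow x) hx.2⟩
    omega
  · have : (Finset.univ.filter fun y => z (0, y) ≠ (z * f) (0, 0)).card ≤ γ.card := by
      refine (Finset.card_le_card fun y hy => ?_).trans hy
      rw [Finset.mem_filter] at hy ⊢
      exact ⟨hy.1, 0, hne _ (hcol y) hy.2⟩
    omega

/-- The total magnetization of a configuration. -/
def totalSpin (z : Fin n × Fin n → ℤˣ) : ℤ := ∑ i, (z i : ℤ)

/-- Configurations with short domain walls near every cross are magnetized. -/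
theorem FewWalls.magnetized {z : Fin n × Fin n → ℤˣ} (hz : FewWalls 4 z) :
    ∃ s : ℤˣ, (n : ℤ) * n < 4 * (s * totalSpin z) := by
  choose s hs hs' using hz.row
  have hconst : ∀ r, s r = s 0 := by
    intro r
    by_contra hne
    have h1 : (Finset.univ : Finset (Fin n)) ⊆ (Finset.univ.filter fun y => z (0, y) ≠ s r) ∪
        (Finset.univ.filter fun y => z (0, y) ≠ s 0) := by
      intro y _
      simp only [Finset.mem_union, Finset.mem_filter, Finset.mem_univ, true_and]
      by_contra! h
      exact hne (h.1.symm.trans h.2)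
    have h2 := (Finset.card_le_card h1).trans (Finset.card_union_le _ _)
    rw [Finset.card_univ, Fintype.card_fin] at h2
    have := hs' r
    have := hs' 0
    omega
  refine ⟨s 0, ?_⟩
  have hrow : ∀ r, (n : ℤ) < 2 * ∑ x, ((s 0 : ℤˣ) : ℤ) * (z (x, r) : ℤ) := by
    intro r
    have h1 : ∀ u v : ℤˣ, (u : ℤ) * (v : ℤ) = 1 - 2 * (if v ≠ u then 1 else 0) := by decide
    simp only [h1, Finset.sum_sub_distrib, ← Finset.mul_sum, Finset.sum_boole]
    have h2 := hs r
    rw [hconst] at h2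
    simp only [Finset.sum_const, Finset.card_univ, Fintype.card_fin, nsmul_eq_mul]
    omega
  have hn : 0 < n := Nat.pos_of_ne_zero (NeZero.ne n)
  have h3 : ∑ _r : Fin n, (n : ℤ) < ∑ r, 2 * ∑ x, ((s 0 : ℤˣ) : ℤ) * (z (x, r) : ℤ) :=
    Finset.sum_lt_sum_of_nonempty ⟨0, Finset.mem_univ _⟩ fun r _ => hrow r
  rw [← Finset.mul_sum, Finset.sum_comm, ← Fintype.sum_prod_type'
    (f := fun x r => ((s 0 : ℤˣ) : ℤ) * (z (x, r) : ℤ)), ← Finset.mul_sum] at h3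
  simp only [Finset.sum_const, Finset.card_univ, Fintype.card_fin, nsmul_eq_mul] at h3
  change (n : ℤ) * n < 2 * (s 0 * totalSpin z) at h3
  have h4 : (0 : ℤ) ≤ n * n := by positivity
  linarith

theorem abs_totalSpin_sub_le (z w : Fin n × Fin n → ℤˣ) :
    |totalSpin z - totalSpin w| ≤ 2 * hammingDist z w := by
  rw [totalSpin, totalSpin, ← Finset.sum_sub_distrib]
  refine (Finset.abs_sum_le_sum_abs _ _).trans ?_
  have h : ∀ u v : ℤˣ, |(u : ℤ) - v| = 2 * (if u ≠ v then 1 else 0) := by decide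
  simp only [h, ← Finset.mul_sum, Finset.sum_boole, hammingDist]
  rfl

theorem exists_domainWall_subset_union (z w : Fin n × Fin n → ℤˣ) :
    ∃ F : Finset (EdgeLabel n), domainWall z ⊆ domainWall w ∪ F ∧
      F.card ≤ 4 * hammingDist w z := by
  set S : Finset (Fin n × Fin n) := Finset.univ.filter fun i => w i ≠ z i with hS
  set F₁ : Finset (EdgeLabel n) := Finset.univ.filter fun l => l.2 ∈ S with hF₁
  set F₂ : Finset (EdgeLabel n) := Finset.univ.filter fun l => tgt l ∈ S with hF₂
  have hc : ((Finset.univ : Finset Bool) ×ˢ S).card = 2 * hammingDist w z := by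
    rw [Finset.card_product, Finset.card_univ, Fintype.card_bool]
    rfl
  have h1 : F₁.card ≤ 2 * hammingDist w z := by
    rw [← hc]
    refine Finset.card_le_card fun l hl => ?_
    simpa [hF₁] using hl
  have h2 : F₂.card ≤ 2 * hammingDist w z := by
    rw [← hc]
    refine Finset.card_le_card_of_injOn (fun l => (l.1, tgt l)) (fun l hl => ?_) ?_
    · simpa [hF₂] using hl
    · rintro ⟨_ | _, x, y⟩ - ⟨_ | _, x', y'⟩ - h <;> simp_all [tgt]
  refine ⟨F₁ ∪ F₂, fun l hl => ?_, (Finset.card_union_le _ _).trans (by omega)⟩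
  simp only [Finset.mem_union, mem_domainWall, hF₁, hF₂, hS, Finset.mem_filter, Finset.mem_univ,
    true_and] at hl ⊢
  by_contra! h
  exact hl (h.2.1.symm.trans (h.1.trans h.2.2))

/-- Changing `R` spins of a configuration enlarges the domain walls near a cross only by a bounded
factor. -/
theorem FewWalls.of_hammingDist_le {R : ℕ} (hR : 1 ≤ R) {z w : Fin n × Fin n → ℤˣ}
    (hw : FewWalls (400 * R) w) (hd : hammingDist w z ≤ R) (hn : 32 * R < n) : FewWalls 4 z := by
  intro r
  obtain ⟨F, hF, hFc⟩ := exists_domainWall_subset_union z w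
  set k := n / (400 * R)
  have hk : ∀ r, (reach PlaquetteAdj (domainWall w) (cross r)).card ≤ k := by
    intro r
    rw [Nat.le_div_iff_mul_le (by omega), mul_comm]
    exact (hw r).le
  have h1 := card_reach_union_le (F := F) (X := cross r) (PlaquetteAdj.mem_nbr (n := n))
    card_plaquetteNbr_le (D := domainWall w) (k := k) fun e => by
      refine (Finset.card_le_card (reach_mono_right ?_)).trans (hk e.2.2)
      simp [cross]
  have h2 := Finset.card_le_card (reach_mono (adj := PlaquetteAdj) (X := cross r) hF)
  have h3 := hk r
  have h4 : 400 * R * k ≤ n := Nat.mul_div_le n (400 * R)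
  have h5 : F.card * (1 + 8 * k) ≤ 4 * R * (1 + 8 * k) := Nat.mul_le_mul_right _ (by omega)
  have h6 : k ≤ R * k := Nat.le_mul_of_pos_left k hR
  nlinarith

open Classical in
/-- The number of sets with at most `m` edges whose components all meet the cross of a common
row. -/
theorem card_rooted_cross_le (m : ℕ) :
    (Finset.univ.filter fun B : Finset (EdgeLabel n) =>
      B.card ≤ m ∧ ∃ r, Rooted PlaquetteAdj (cross r) B).card ≤ 2 ^ (4 * n + 9 * m) := by
  have h1 : (Finset.univ.filter fun B : Finset (EdgeLabel n) =>
      B.card ≤ m ∧ ∃ r, Rooted PlaquetteAdj (cross r) B) ⊆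
      (Finset.univ : Finset (Fin n)).biUnion fun r => Finset.univ.filter fun B =>
        Rooted PlaquetteAdj (cross r) B ∧
          (cross r ∪ B ∪ B.biUnion plaquetteNbr).card ≤ 3 * n + 9 * m := by
    intro B hB
    obtain ⟨-, hm, r, hr⟩ := Finset.mem_filter.1 hB
    refine Finset.mem_biUnion.2 ⟨r, Finset.mem_univ _, Finset.mem_filter.2
      ⟨Finset.mem_univ _, hr, ?_⟩⟩
    have := card_closedNbr_le (X := cross r) (B := B) card_plaquetteNbr_le
    have := card_cross_le r
    omega
  refine (Finset.card_le_card h1).trans ((Finset.card_biUnion_le_card_mul _ _ _ fun r _ =>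
    card_rooted_le (X := cross r) _ PlaquetteAdj.mem_nbr _).trans ?_)
  rw [Finset.card_univ, Fintype.card_fin]
  calc n * 2 ^ (3 * n + 9 * m) ≤ 2 ^ n * 2 ^ (3 * n + 9 * m) :=
        Nat.mul_le_mul_right _ Nat.lt_two_pow_self.le
    _ = 2 ^ (4 * n + 9 * m) := by rw [← pow_add]; congr 1; ring

end Torus

/-! ### Edges and energy of the Ising model on the torus -/

section Edges

variable {n : ℕ} [NeZero n]

theorem torus_adj_iff (hn : 3 ≤ n) {i j : Fin n × Fin n} :
    (torus n).Adj i j ↔ ∃ l : EdgeLabel n, s(l.2, tgt l) = s(i, j) := by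
  obtain ⟨m, rfl⟩ : ∃ m, n = m + 1 := ⟨n - 1, by omega⟩
  have h1 : ∀ x : Fin (m + 1), x + 1 ≠ x := by
    intro x h
    have := congrArg Fin.val (add_eq_left.1 h)
    rw [Fin.val_one', Nat.mod_eq_of_lt (by omega)] at this
    simp at this
  have hadj : ∀ x y : Fin (m + 1),
      (SimpleGraph.cycleGraph (m + 1)).Adj x y ↔ y = x + 1 ∨ x = y + 1 := by
    intro x y
    rw [SimpleGraph.cycleGraph_eq_circulantGraph, SimpleGraph.circulantGraph_adj]
    simp only [Set.mem_singleton_iff, sub_eq_iff_eq_add']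
    constructor
    · rintro ⟨-, h | h⟩
      · exact Or.inr h
      · exact Or.inl h
    · rintro (rfl | rfl)
      · exact ⟨(h1 _).symm, Or.inr rfl⟩
      · exact ⟨h1 _, Or.inl rfl⟩
  obtain ⟨x, y⟩ := i
  obtain ⟨x', y'⟩ := j
  rw [torus, SimpleGraph.boxProd_adj, hadj, hadj]
  constructor
  · rintro (⟨h | h, h'⟩ | ⟨h | h, h'⟩) <;> simp only at h h' <;> subst h <;> subst h'
    · exact ⟨(false, x, y), rfl⟩
    · exact ⟨(false, x', y), Sym2.eq_swap⟩
    · exact ⟨(true, x, y), rfl⟩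
    · exact ⟨(true, x, y'), Sym2.eq_swap⟩
  · rintro ⟨⟨_ | _, a, b⟩, h⟩ <;>
    · simp only [tgt, Sym2.eq_iff, Prod.mk.injEq] at h
      rcases h with ⟨⟨rfl, rfl⟩, rfl, rfl⟩ | ⟨⟨rfl, rfl⟩, rfl, rfl⟩ <;> simp

theorem edgeLabel_injective (hn : 3 ≤ n) :
    Function.Injective fun l : EdgeLabel n => s(l.2, tgt l) := by
  have h1 : (1 : Fin n) ≠ 0 := by
    intro h
    have := congrArg Fin.val h
    rw [Fin.val_one', Nat.mod_eq_of_lt (by omega)] at this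
    simp at this
  have h2 : (1 : Fin n) + 1 ≠ 0 := by
    intro h
    have := congrArg Fin.val h
    rw [Fin.val_add, Fin.val_one', Nat.mod_eq_of_lt (by omega : 1 < n),
      Nat.mod_eq_of_lt (by omega)] at this
    simp at this
  rintro ⟨_ | _, x, y⟩ ⟨_ | _, x', y'⟩ h <;>
    simp only [tgt, Sym2.eq_iff, Prod.mk.injEq] at h <;>
    rcases h with ⟨⟨ha, hb⟩, hc, hd⟩ | ⟨⟨ha, hb⟩, hc, hd⟩ <;> subst_vars <;>
    simp_all [add_assoc]

/-- The labelling of the edges of the torus; for `n ≥ 3` distinct labels give distinct edges. -/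
noncomputable def edgeEquiv (hn : 3 ≤ n) : EdgeLabel n ≃ (torus n).edgeSet :=
  Equiv.ofBijective
    (fun l => ⟨s(l.2, tgt l), (torus_adj_iff hn).2 ⟨l, rfl⟩⟩)
    ⟨fun _ _ h => edgeLabel_injective hn (congrArg Subtype.val h), by
      rintro ⟨e, he⟩
      induction e with
      | h i j =>
        obtain ⟨l, hl⟩ := (torus_adj_iff hn).1 he
        exact ⟨l, Subtype.ext hl⟩⟩

theorem coe_edgeEquiv (hn : 3 ≤ n) (l : EdgeLabel n) :
    (edgeEquiv hn l : Sym2 (Fin n × Fin n)) = s(l.2, tgt l) := rfl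

theorem dwCheck_edgeEquiv (hn : 3 ≤ n) (l : EdgeLabel n) (z : Fin n × Fin n → ℤˣ) :
    dwCheck (torus n) (edgeEquiv hn l) z = if l ∈ domainWall z then 1 else 0 := by
  have h : ∀ u v : ℤˣ, (u : ℤ) * v = if u ≠ v then -1 else 1 := by decide
  have h1 : dwCheck (torus n) (edgeEquiv hn l) z =
      (1 - ((z l.2 : ℤ) : ℝ) * ((z (tgt l) : ℤ) : ℝ)) / 2 := rfl
  rw [h1, ← Int.cast_mul, h]
  simp only [mem_domainWall]
  split_ifs <;> norm_num

theorem dwCheck_eq_zero_or_one (hn : 3 ≤ n) (e : (torus n).edgeSet) (z : Fin n × Fin n → ℤˣ) :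
    dwCheck (torus n) e z = 0 ∨ dwCheck (torus n) e z = 1 := by
  obtain ⟨l, rfl⟩ := (edgeEquiv hn).surjective e
  rw [dwCheck_edgeEquiv]
  split_ifs <;> simp

theorem dwCheck_const_mul (hn : 3 ≤ n) (e : (torus n).edgeSet) (s : ℤˣ)
    (z : Fin n × Fin n → ℤˣ) :
    dwCheck (torus n) e (fun i => s * z i) = dwCheck (torus n) e z := by
  obtain ⟨l, rfl⟩ := (edgeEquiv hn).surjective e
  rw [dwCheck_edgeEquiv, dwCheck_edgeEquiv, domainWall_const_mul]

theorem sum_dwCheck (hn : 3 ≤ n) (B : Finset (EdgeLabel n)) (z : Fin n × Fin n → ℤˣ) :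
    ∑ e ∈ B.map (edgeEquiv hn).toEmbedding, dwCheck (torus n) e z =
      ((domainWall z ∩ B).card : ℝ) := by
  rw [Finset.sum_map]
  simp only [Equiv.coe_toEmbedding, dwCheck_edgeEquiv, Finset.sum_boole]
  rw [Finset.filter_mem_eq_inter, Finset.inter_comm]

theorem isingEnergy_eq (hn : 3 ≤ n) (J : ℝ) (z : Fin n × Fin n → ℤˣ) :
    isingEnergy (torus n) J z = J * ((domainWall z).card : ℝ) := by
  rw [isingEnergy, ← Finset.mul_sum, ← (edgeEquiv hn).sum_comp]
  simp only [dwCheck_edgeEquiv, Finset.sum_boole, Finset.filter_univ_mem]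

theorem allExcited_iff (hn : 3 ≤ n) {B : Finset (EdgeLabel n)} {z : Fin n × Fin n → ℤˣ} :
    AllExcited (dwCheck (torus n)) (B.map (edgeEquiv hn).toEmbedding) z ↔ B ⊆ domainWall z := by
  simp only [AllExcited, Finset.mem_map, Equiv.coe_toEmbedding, forall_exists_index, and_imp,
    forall_apply_eq_imp_iff₂, dwCheck_edgeEquiv]
  refine forall₂_congr fun l _ => ?_
  split_ifs with h <;> simp [h]

theorem mem_edge_of_actsOn {e : (torus n).edgeSet} {i : Fin n × Fin n}
    (h : ActsOn (diagOp (dwCheck (torus n) e)) i) : i ∈ (e : Sym2 (Fin n × Fin n)) := by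
  by_contra hi
  refine h (supportedOn_diagOp fun z w hzw => ?_)
  obtain ⟨e, he⟩ := e
  induction e with
  | h a b =>
    have ha : z a = w a := hzw a (by
      simp only [Finset.mem_erase, Finset.mem_univ, and_true]
      rintro rfl
      exact hi (Sym2.mem_mk_left _ _))
    have hb : z b = w b := hzw b (by
      simp only [Finset.mem_erase, Finset.mem_univ, and_true]
      rintro rfl
      exact hi (Sym2.mem_mk_right _ _))
    change (1 - ((z a : ℤ) : ℝ) * ((z b : ℤ) : ℝ)) / 2 =
      (1 - ((w a : ℤ) : ℝ) * ((w b : ℤ) : ℝ)) / 2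
    rw [ha, hb]

theorem ncard_sites_actsOn_le (e : (torus n).edgeSet) :
    {i | ActsOn (diagOp (dwCheck (torus n) e)) i}.ncard ≤ 4 := by
  have h : {i | ActsOn (diagOp (dwCheck (torus n) e)) i} ⊆
      {i | i ∈ (e : Sym2 (Fin n × Fin n))} := fun i => mem_edge_of_actsOn
  refine (Set.ncard_le_ncard h (Set.toFinite _)).trans ?_
  obtain ⟨e, he⟩ := e
  induction e with
  | h a b =>
    have h2 : {i | i ∈ s(a, b)} = {a, b} := by
      ext i
      simp
    rw [h2]
    have := Set.ncard_insert_le a {b}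
    rw [Set.ncard_singleton] at this
    omega

theorem ncard_checks_actsOn_le (hn : 3 ≤ n) (i : Fin n × Fin n) :
    {e | ActsOn (diagOp (dwCheck (torus n) e)) i}.ncard ≤ 4 := by
  set T : Finset (EdgeLabel n) :=
    {(false, i), (true, i), (false, i.1 - 1, i.2), (true, i.1, i.2 - 1)}
  have h : {e | ActsOn (diagOp (dwCheck (torus n) e)) i} ⊆
      ((T.map (edgeEquiv hn).toEmbedding : Finset _) : Set (torus n).edgeSet) := by
    intro e he
    have he := mem_edge_of_actsOn he
    obtain ⟨l, rfl⟩ := (edgeEquiv hn).surjective e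
    rw [coe_edgeEquiv, Sym2.mem_iff] at he
    rw [Finset.mem_coe]
    refine Finset.mem_map_of_mem (edgeEquiv hn).toEmbedding ?_
    rcases he with rfl | rfl <;> obtain ⟨_ | _, x, y⟩ := l <;> simp [T, tgt]
  refine (Set.ncard_le_ncard h (Set.toFinite _)).trans ?_
  rw [Set.ncard_coe_finset, Finset.card_map]
  exact Finset.card_le_four

theorem flipOn_eq_mul (f z : Fin n × Fin n → ℤˣ) :
    flipOn (Finset.univ.filter fun i => f i ≠ 1) z = z * f := by
  funext i
  have h : ∀ u v : ℤˣ, (if v ≠ 1 then -u else u) = u * v := by decide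
  simp only [flipOn, Finset.mem_filter, Finset.mem_univ, true_and, Pi.mul_apply, h]

/-- Flipping the region bounded by a domain wall `B` exchanges excited and unexcited checks of `B`
and leaves all other checks unchanged. If a fraction `4 / 5` of `B` is excited, this lowers the
energy by `(2 * 4 / 5 - 1) * J` per edge of `B`. -/
theorem strongEnergyCondition_domainWall (hn : 3 ≤ n) {J : ℝ} (hJ : 0 < J)
    (f : Fin n × Fin n → ℤˣ) :
    StrongEnergyCondition (torus n) (dwCheck (torus n)) (isingEnergy (torus n) J) (6 / 10 * J) 1
      ((domainWall f).map (edgeEquiv hn).toEmbedding) (Finset.univ.filter fun i => f i ≠ 1) := by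
  constructor
  · intro z hz
    rw [sum_dwCheck, Finset.card_map] at hz
    rw [flipOn_eq_mul, isingEnergy_eq hn, isingEnergy_eq hn, domainWall_mul, Finset.card_map]
    have h1 : (symmDiff (domainWall z) (domainWall f)).card +
        2 * (domainWall z ∩ domainWall f).card =
        (domainWall z).card + (domainWall f).card := by
      have h2 := Finset.card_sdiff_add_card_inter (domainWall z) (domainWall f)
      have h3 := Finset.card_sdiff_add_card_inter (domainWall f) (domainWall z)
      rw [Finset.inter_comm] at h3
      have h4 : (symmDiff (domainWall z) (domainWall f)).card =
          (domainWall z \ domainWall f).card + (domainWall f \ domainWall z).card :=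
        Finset.card_union_of_disjoint disjoint_sdiff_sdiff
      omega
    have h5 : ((symmDiff (domainWall z) (domainWall f)).card : ℝ) +
        2 * ((domainWall z ∩ domainWall f).card : ℝ) =
        (domainWall z).card + (domainWall f).card := by exact_mod_cast h1
    rw [mul_right_comm, mul_comm _ J, ← mul_add]
    exact mul_le_mul_of_nonneg_left (by linarith) hJ.le
  · rw [one_mul, Finset.card_map, Nat.cast_le]
    have h : {i | i ∈ (Finset.univ.filter fun i => f i ≠ 1) ∧
        ∃ j, j ∉ (Finset.univ.filter fun i => f i ≠ 1) ∧ (torus n).Adj i j} ⊆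
        (((domainWall f).image fun l => if f l.2 ≠ 1 then l.2 else tgt l : Finset _) :
          Set (Fin n × Fin n)) := by
      rintro i ⟨hi, j, hj, hij⟩
      simp only [Finset.mem_filter, Finset.mem_univ, true_and, not_not] at hi hj
      obtain ⟨l, hl⟩ := (torus_adj_iff hn).1 hij
      rw [Finset.mem_coe, Finset.mem_image]
      refine ⟨l, ?_⟩
      rw [mem_domainWall]
      rcases Sym2.eq_iff.1 hl with ⟨h1, h2⟩ | ⟨h1, h2⟩
      · rw [h1, h2, hj, if_pos hi]
        exact ⟨hi, rfl⟩
      · rw [h1, h2, hj, if_neg (not_not.2 rfl)]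
        exact ⟨hi.symm, rfl⟩
    refine (Set.ncard_le_ncard h (Set.toFinite _)).trans ?_
    rw [Set.ncard_coe_finset]
    exact Finset.card_image_le

theorem magnetization_eq_diagOp :
    magnetization (Fin n × Fin n) =
      diagOp fun z => (totalSpin z : ℝ) / ((n : ℝ) * n) := by
  ext ψ z
  simp only [magnetization, pauliZ, smul_apply, sum_apply,
    PiLp.smul_apply, WithLp.ofLp_sum, Finset.sum_apply, diagOp_apply, ← Finset.sum_mul, smul_eq_mul,
    Fintype.card_prod, Fintype.card_fin, totalSpin]
  push_cast
  rw [div_eq_inv_mul, mul_assoc]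

end Edges

/-! ### The two phases -/

section Phases

variable {n : ℕ} [NeZero n]

/-- The configurations of sign `s` with short domain walls: the walls meeting any given cross have
fewer than `n / q` edges in total, and the magnetization has sign `s` and modulus above `1 / 4`. -/
def phase (n q : ℕ) [NeZero n] (s : ℤˣ) : Set (Fin n × Fin n → ℤˣ) :=
  {z | FewWalls q z ∧ (n : ℤ) * n < 4 * (s * totalSpin z)}

theorem FewWalls.exists_mem_phase {z : Fin n × Fin n → ℤˣ} (hz : FewWalls 4 z) :
    ∃ s, z ∈ phase n 4 s :=
  hz.magnetized.imp fun _ hs => ⟨hz, hs⟩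

theorem phase_mono {q q' : ℕ} (h : q' ≤ q) (s : ℤˣ) : phase n q s ⊆ phase n q' s :=
  fun _ hz => ⟨hz.1.mono h, hz.2⟩

theorem totalSpin_const_mul (s : ℤˣ) (z : Fin n × Fin n → ℤˣ) :
    totalSpin (fun i => s * z i) = s * totalSpin z := by
  simp [totalSpin, Finset.mul_sum]

theorem const_mul_mem_phase {q : ℕ} {s : ℤˣ} {z : Fin n × Fin n → ℤˣ} (t : ℤˣ)
    (hz : z ∈ phase n q s) : (fun i => t * z i) ∈ phase n q (t * s) := by
  refine ⟨fun r => ?_, ?_⟩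
  · rw [domainWall_const_mul]
    exact hz.1 r
  · have h : ((t * s : ℤˣ) : ℤ) * totalSpin (fun i => t * z i) = s * totalSpin z := by
      have h1 : ((t : ℤ)) * t = 1 := by
        rw [← Units.val_mul, Int.units_mul_self, Units.val_one]
      rw [totalSpin_const_mul, Units.val_mul]
      linear_combination (s : ℤ) * totalSpin z * h1
    rw [h]
    exact hz.2

theorem phase_eq_image (q : ℕ) (s s' : ℤˣ) :
    phase n q s = (fun z i => s * s' * z i) '' phase n q s' := by
  ext z
  constructor
  · intro hz
    refine ⟨fun i => s * s' * z i, ?_, ?_⟩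
    · have := const_mul_mem_phase (s * s') hz
      rwa [mul_right_comm, Int.units_mul_self, one_mul] at this
    · funext i
      simp only
      rw [← mul_assoc, Int.units_mul_self, one_mul]
  · rintro ⟨w, hw, rfl⟩
    have := const_mul_mem_phase (s * s') hw
    rwa [mul_assoc, Int.units_mul_self, mul_one] at this

theorem one_mem_phase {q : ℕ} (s : ℤˣ) : (fun _ => s) ∈ phase n q s := by
  have hn : 0 < n := Nat.pos_of_ne_zero (NeZero.ne n)
  have h1 : (1 : Fin n × Fin n → ℤˣ) ∈ phase n q 1 := by
    refine ⟨fun r => ?_, ?_⟩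
    · have h : reach PlaquetteAdj (domainWall (1 : Fin n × Fin n → ℤˣ)) (cross r) = ∅ :=
        Finset.subset_empty.1 (reach_subset.trans (by simp [domainWall]))
      rw [h]
      simpa using hn
    · simp only [totalSpin, Pi.one_apply, Units.val_one, Finset.sum_const,
        Finset.card_univ, Fintype.card_prod, Fintype.card_fin, nsmul_eq_mul, one_mul, mul_one]
      push_cast
      nlinarith
  simpa using const_mul_mem_phase s h1

theorem hammingDist_of_phase_ne {q q' : ℕ} {s s' : ℤˣ} (hs : s ≠ s') {z w : Fin n × Fin n → ℤˣ}
    (hz : z ∈ phase n q s) (hw : w ∈ phase n q' s') : n * n < 4 * hammingDist z w := by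
  have h1 := hz.2
  have h2 := hw.2
  have h3 := abs_le.1 (abs_totalSpin_sub_le z w)
  obtain ⟨h3, h4⟩ := h3
  zify
  rcases Int.units_eq_one_or s with rfl | rfl <;> rcases Int.units_eq_one_or s' with rfl | rfl
  · exact (hs rfl).elim
  · simp only [Units.val_one, Units.val_neg] at h1 h2
    linarith
  · simp only [Units.val_one, Units.val_neg] at h1 h2
    linarith
  · exact (hs rfl).elim

theorem disjoint_phase {q q' : ℕ} {s s' : ℤˣ} (hs : s ≠ s') :
    Disjoint (phase n q s) (phase n q' s') := by
  rw [Set.disjoint_left]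
  intro z hz hz'
  have := hammingDist_of_phase_ne hs hz hz'
  simp at this

/-- The sign of the phase cannot change over a short Hamming distance. -/
theorem FewWalls.mem_phase_of_hammingDist_le {q : ℕ} {s : ℤˣ} {z w : Fin n × Fin n → ℤˣ}
    (hw : FewWalls 4 w) (hz : z ∈ phase n q s) (hd : 4 * hammingDist z w ≤ n * n) :
    w ∈ phase n 4 s := by
  obtain ⟨s', hs'⟩ := hw.exists_mem_phase
  by_cases h : s = s'
  · rwa [h]
  · have := hammingDist_of_phase_ne h hz hs'
    omega

theorem mem_phase_of_hammingDist_le {R : ℕ} (hR : 1 ≤ R) {s : ℤˣ} {z w : Fin n × Fin n → ℤˣ}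
    (hz : z ∈ phase n (400 * R) s) (hd : hammingDist z w ≤ R) (hn : 32 * R < n) :
    w ∈ phase n 4 s :=
  (hz.1.of_hammingDist_le hR hd hn).mem_phase_of_hammingDist_le hz (by nlinarith)

/-- The region enclosed by a short domain wall can be chosen so small that flipping it does not
leave the phase. -/
theorem exists_flip_preserving_phase {B : Finset (EdgeLabel n)}
    (hB : ∃ f : Fin n × Fin n → ℤˣ, domainWall f = B) (hn : 4 * B.card < n) :
    ∃ f : Fin n × Fin n → ℤˣ, domainWall f = B ∧
      ∀ s, ∀ z ∈ phase n 4 s, B ⊆ domainWall z → z * f ∈ phase n 4 s := by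
  obtain ⟨f₀, rfl⟩ := hB
  obtain ⟨f, hf, hx, hy⟩ := exists_small_domainWall_eq (γ := domainWall f₀) subset_rfl
    (fun _ _ b hb _ => hb) (by omega)
  refine ⟨f, hf, fun s z hz hBz => ?_⟩
  refine (hz.1.mono_wall ?_).mem_phase_of_hammingDist_le hz ?_
  · rw [domainWall_mul_of_subset (hf ▸ hBz)]
    exact Finset.sdiff_subset
  · have h1 : hammingDist z (z * f) = (Finset.univ.filter fun i => f i ≠ 1).card := by
      rw [hammingDist]
      congr 1
      ext i
      simp
    rw [h1]
    have h2 := (card_neg_le f).trans (Nat.mul_le_mul hx hy)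
    nlinarith

/-! ### The families of indicators -/

open Classical in
/-- The indicators of the bottlenecks: domain walls whose length is between `n / q` and `n / 4` and
whose components all meet the cross of a common row. -/
noncomputable def bottleneckWalls (n q : ℕ) [NeZero n] : Finset (Finset (EdgeLabel n)) :=
  Finset.univ.filter fun B => (∃ f : Fin n × Fin n → ℤˣ, domainWall f = B) ∧ n ≤ q * B.card ∧
    4 * B.card < n ∧ ∃ r, Rooted PlaquetteAdj (cross r) B

open Classical in
/-- The indicators of the configurations outside the two phases: domain walls of length at least
`n / 4` whose components all meet the cross of a common row. -/
noncomputable def outerWalls (n : ℕ) [NeZero n] : Finset (Finset (EdgeLabel n)) :=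
  Finset.univ.filter fun B => (∃ f : Fin n × Fin n → ℤˣ, domainWall f = B) ∧ n ≤ 4 * B.card ∧
    ∃ r, Rooted PlaquetteAdj (cross r) B

theorem mem_bottleneckWalls {q : ℕ} {B : Finset (EdgeLabel n)} : B ∈ bottleneckWalls n q ↔
    (∃ f : Fin n × Fin n → ℤˣ, domainWall f = B) ∧ n ≤ q * B.card ∧
    4 * B.card < n ∧ ∃ r, Rooted PlaquetteAdj (cross r) B := by
  simp [bottleneckWalls]

theorem mem_outerWalls {B : Finset (EdgeLabel n)} : B ∈ outerWalls n ↔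
    (∃ f : Fin n × Fin n → ℤˣ, domainWall f = B) ∧ n ≤ 4 * B.card ∧
    ∃ r, Rooted PlaquetteAdj (cross r) B := by
  simp [outerWalls]

theorem exists_bottleneckWalls_subset {q : ℕ} {s : ℤˣ} {z : Fin n × Fin n → ℤˣ}
    (hz : z ∈ phase n 4 s) (hz' : z ∉ phase n q s) :
    ∃ B ∈ bottleneckWalls n q, B ⊆ domainWall z := by
  have h : ¬ FewWalls q z := fun h => hz' ⟨h, hz.2⟩
  simp only [FewWalls, not_forall, not_lt] at h
  obtain ⟨r, hr⟩ := h
  exact ⟨_, mem_bottleneckWalls.2 ⟨exists_domainWall_eq_reach z r, hr, hz.1 r, r, rooted_reach⟩,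
    reach_subset⟩

theorem exists_outerWalls_subset {z : Fin n × Fin n → ℤˣ} (hz : ∀ s, z ∉ phase n 4 s) :
    ∃ B ∈ outerWalls n, B ⊆ domainWall z := by
  have h : ¬ FewWalls 4 z := fun h => h.exists_mem_phase.elim hz
  simp only [FewWalls, not_forall, not_lt] at h
  obtain ⟨r, hr⟩ := h
  exact ⟨_, mem_outerWalls.2 ⟨exists_domainWall_eq_reach z r, hr, r, rooted_reach⟩, reach_subset⟩

theorem two_pow_le_exp (k : ℕ) : ((2 ^ k : ℕ) : ℝ) ≤ Real.exp k := by
  rw [Nat.cast_pow, ← Real.exp_one_pow]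
  refine pow_le_pow_left₀ (by norm_num) ?_ k
  have := Real.add_one_le_exp 1
  push_cast
  linarith

theorem card_bottleneckWalls_le (q : ℕ) :
    ((bottleneckWalls n q).card : ℝ) ≤ Real.exp (7 * n) := by
  classical
  have h1 : bottleneckWalls n q ⊆ Finset.univ.filter fun B : Finset (EdgeLabel n) =>
      B.card ≤ n / 4 ∧ ∃ r, Rooted PlaquetteAdj (cross r) B := by
    intro B hB
    obtain ⟨-, -, h, hr⟩ := mem_bottleneckWalls.1 hB
    exact Finset.mem_filter.2 ⟨Finset.mem_univ _, by omega, hr⟩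
  have h2 : (2 : ℕ) ^ (4 * n + 9 * (n / 4)) ≤ 2 ^ (7 * n) :=
    Nat.pow_le_pow_right (by norm_num) (by omega)
  have h3 := (Finset.card_le_card h1).trans ((card_rooted_cross_le (n / 4)).trans h2)
  have h4 := (Nat.cast_le (α := ℝ)).2 h3
  have h5 := two_pow_le_exp (7 * n)
  push_cast at h4 h5 ⊢
  exact h4.trans h5

theorem card_outerWalls_le (m : ℕ) :
    (((outerWalls n).filter fun B => B.card = m).card : ℝ) ≤ Real.exp (25 * m) := by
  classical
  rcases Nat.lt_or_ge (4 * m) n with hm | hm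
  · have h : (outerWalls n).filter (fun B => B.card = m) = ∅ := by
      refine Finset.filter_eq_empty_iff.2 fun B hB h => ?_
      have := (mem_outerWalls.1 hB).2.1
      omega
    rw [h]
    simpa using (Real.exp_pos _).le
  have h1 : (outerWalls n).filter (fun B => B.card = m) ⊆
      Finset.univ.filter fun B : Finset (EdgeLabel n) =>
        B.card ≤ m ∧ ∃ r, Rooted PlaquetteAdj (cross r) B := by
    intro B hB
    rw [Finset.mem_filter] at hB ⊢
    obtain ⟨-, -, hr⟩ := mem_outerWalls.1 hB.1
    exact ⟨Finset.mem_univ _, hB.2.le, hr⟩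
  have h2 : (2 : ℕ) ^ (4 * n + 9 * m) ≤ 2 ^ (25 * m) :=
    Nat.pow_le_pow_right (by norm_num) (by omega)
  have h3 := (Finset.card_le_card h1).trans ((card_rooted_cross_le m).trans h2)
  have h4 := (Nat.cast_le (α := ℝ)).2 h3
  have h5 := two_pow_le_exp (25 * m)
  push_cast at h4 h5 ⊢
  exact h4.trans h5

end Phases

/-! ### Verification of the bottleneck structure and the Peierls condition -/

section Assembly

variable {n : ℕ} [NeZero n]

/-- A family of sets of edge labels, as a family of sets of edges of the torus. -/
noncomputable def edgeFamily (hn : 3 ≤ n) (𝓑 : Finset (Finset (EdgeLabel n))) :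
    Finset (Finset (torus n).edgeSet) :=
  𝓑.map (Finset.mapEmbedding (edgeEquiv hn).toEmbedding).toEmbedding

theorem mem_edgeFamily {hn : 3 ≤ n} {𝓑 : Finset (Finset (EdgeLabel n))}
    {B : Finset (torus n).edgeSet} :
    B ∈ edgeFamily hn 𝓑 ↔ ∃ B₀ ∈ 𝓑, B₀.map (edgeEquiv hn).toEmbedding = B := by
  simp [edgeFamily]

theorem card_filter_edgeFamily (hn : 3 ≤ n) (𝓑 : Finset (Finset (EdgeLabel n))) (m : ℕ) :
    ((edgeFamily hn 𝓑).filter fun B => B.card = m).card =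
      (𝓑.filter fun B => B.card = m).card := by
  rw [edgeFamily, Finset.filter_map, Finset.card_map]
  congr 2
  ext B
  simp

/-- The sign of the spins in each of the two phases. -/
def phaseSign (k : Fin 2) : ℤˣ := if k = 0 then 1 else -1

theorem phaseSign_injective : Function.Injective phaseSign := by decide

theorem exists_phaseSign_eq (s : ℤˣ) : ∃ k, phaseSign k = s := by
  revert s
  decide

/-- The wells of the two phases. -/
def well (n R : ℕ) [NeZero n] (k : Fin 2) : Set (Fin n × Fin n → ℤˣ) :=
  phase n (400 * R) (phaseSign k)

/-- The bottlenecks that surround the wells. -/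
def rim (n R : ℕ) [NeZero n] (k : Fin 2) : Set (Fin n × Fin n → ℤˣ) :=
  phase n 4 (phaseSign k) \ well n R k

theorem well_union_rim {R : ℕ} (hR : 1 ≤ R) (k : Fin 2) :
    well n R k ∪ rim n R k = phase n 4 (phaseSign k) :=
  Set.union_sdiff_cancel (phase_mono (by omega) _)

theorem isSymmetricBottleneck_well {R : ℕ} (hR : 1 ≤ R) (hn : 3 ≤ n) (hRn : 32 * R < n) :
    IsSymmetricBottleneck R (dwCheck (torus n)) (well n R) (rim n R)
      fun _ => edgeFamily hn (bottleneckWalls n (400 * R)) where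
  one_le := hR
  wells_disconnected k k' hk z hz z' hz' := by
    have := hammingDist_of_phase_ne (phaseSign_injective.ne hk) hz hz'
    nlinarith
  disjoint k := Set.disjoint_sdiff_right
  bottleneck k z hz z' hd := by
    rw [well_union_rim hR]
    exact mem_phase_of_hammingDist_le hR hz hd hRn
  detects k z hz := by
    obtain ⟨B, hB, hBz⟩ := exists_bottleneckWalls_subset hz.1 hz.2
    exact ⟨_, mem_edgeFamily.2 ⟨B, hB, rfl⟩, (allExcited_iff hn).2 hBz⟩
  symmetric k k' := by
    have hinj : Function.Injective
        fun (z : Fin n × Fin n → ℤˣ) i => phaseSign k * phaseSign k' * z i := by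
      intro z w h
      funext i
      exact mul_left_cancel (congrFun h i)
    refine ⟨phaseSign k * phaseSign k', phase_eq_image _ _ _, ?_⟩
    rw [rim, rim, Set.image_sdiff hinj, well, well, ← phase_eq_image, ← phase_eq_image]
  check_values := dwCheck_eq_zero_or_one hn
  check_symmetric := dwCheck_const_mul hn

theorem energy_of_domainWall (hn : 3 ≤ n) {J : ℝ} (hJ : 0 < J) {B : Finset (EdgeLabel n)}
    (hB : ∃ f : Fin n × Fin n → ℤˣ, domainWall f = B) (z : Fin n × Fin n → ℤˣ)
    (hz : 4 / 5 * ((B.map (edgeEquiv hn).toEmbedding).card : ℝ) ≤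
      ∑ e ∈ B.map (edgeEquiv hn).toEmbedding, dwCheck (torus n) e z) :
    6 / 10 * J * ((B.map (edgeEquiv hn).toEmbedding).card : ℝ) ≤ isingEnergy (torus n) J z := by
  obtain ⟨f, rfl⟩ := hB
  have h := (strongEnergyCondition_domainWall hn hJ f).1 z hz
  have h2 : 0 ≤ isingEnergy (torus n) J (flipOn (Finset.univ.filter fun i => f i ≠ 1) z) := by
    rw [isingEnergy_eq hn]
    positivity
  linarith

theorem isGlobalQPC_well {R : ℕ} (hR : 1 ≤ R) (hn : 3 ≤ n) (hRn : 32 * R < n) {J : ℝ}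
    (hJ : 0 < J) :
    IsGlobalQPC 4 R (fun e => diagOp (dwCheck (torus n) e)) (diagOp (isingEnergy (torus n) J))
      (6 / 10 * J) (2800 * R) (1 / (400 * R) * n) (fun k => spanKets (well n R k))
      (fun k => spanKets (rim n R k)) (fun _ => edgeFamily hn (bottleneckWalls n (400 * R)))
      (edgeFamily hn (outerWalls n)) := by
  have hR' : (1 : ℝ) ≤ R := by exact_mod_cast hR
  have hsize : ∀ B : Finset (EdgeLabel n), n ≤ 400 * R * B.card →
      1 / (400 * R) * (n : ℝ) ≤ ((B.map (edgeEquiv hn).toEmbedding).card : ℝ) := by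
    intro B hB
    rw [Finset.card_map, one_div_mul_eq_div, div_le_iff₀' (by positivity)]
    exact_mod_cast hB
  refine isGlobalQPC_of_classical (isSymmetricBottleneck_well hR hn hRn) ncard_sites_actsOn_le
    (fun i => ⟨Set.toFinite _, ncard_checks_actsOn_le hn i⟩) ?_ ?_ ?_ ?_ ?_ ?_ ?_ ?_ ?_ ?_ ?_
  · intro k
    rw [edgeFamily, Finset.card_map]
    have h : (2800 * R : ℝ) * (1 / (400 * R) * n) = 7 * n := by
      field_simp
      norm_num
    rw [h]
    exact card_bottleneckWalls_le _
  · intro k B hB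
    obtain ⟨B, hB₀, rfl⟩ := mem_edgeFamily.1 hB
    exact hsize B (mem_bottleneckWalls.1 hB₀).2.1
  · intro z
    rw [isingEnergy_eq hn]
    positivity
  · intro k
    refine ⟨fun _ => phaseSign k, Or.inl (one_mem_phase _), ?_⟩
    rw [isingEnergy_eq hn]
    simp [domainWall]
  · refine ⟨1, ?_⟩
    rw [isingEnergy_eq hn]
    simp [domainWall]
  · intro k B hB
    obtain ⟨B, hB₀, rfl⟩ := mem_edgeFamily.1 hB
    exact energy_of_domainWall hn hJ (mem_bottleneckWalls.1 hB₀).1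
  · intro k k' hk
    rw [well_union_rim hR, well_union_rim hR]
    exact disjoint_phase (phaseSign_injective.ne hk)
  · intro z hz
    obtain ⟨B, hB, hBz⟩ := exists_outerWalls_subset (z := z) fun s => by
      obtain ⟨k, rfl⟩ := exists_phaseSign_eq s
      rw [← well_union_rim hR]
      exact hz k
    exact ⟨_, mem_edgeFamily.2 ⟨B, hB, rfl⟩, (allExcited_iff hn).2 hBz⟩
  · intro B hB
    obtain ⟨B, hB₀, rfl⟩ := mem_edgeFamily.1 hB
    exact energy_of_domainWall hn hJ (mem_outerWalls.1 hB₀).1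
  · intro B hB
    obtain ⟨B, hB₀, rfl⟩ := mem_edgeFamily.1 hB
    refine hsize B ((mem_outerWalls.1 hB₀).2.1.trans (Nat.mul_le_mul_right _ ?_))
    omega
  · intro m
    rw [card_filter_edgeFamily]
    refine (card_outerWalls_le m).trans (Real.exp_le_exp.2 ?_)
    exact mul_le_mul_of_nonneg_right (by linarith) (Nat.cast_nonneg m)

theorem phase_magnetization {q : ℕ} {s : ℤˣ} {z : Fin n × Fin n → ℤˣ} (hz : z ∈ phase n q s) :
    1 / 4 < ((s : ℤ) : ℝ) * ((totalSpin z : ℝ) / ((n : ℝ) * n)) := by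
  have hn : (0 : ℝ) < n := by exact_mod_cast Nat.pos_of_ne_zero (NeZero.ne n)
  have h : ((n : ℝ) * n) < 4 * (((s : ℤ) : ℝ) * totalSpin z) := by exact_mod_cast hz.2
  rw [← mul_div_assoc, lt_div_iff₀ (by positivity)]
  linarith

end Assembly

end Peierls

theorem mainTheorem9 :
    ∃ cb : ℝ, 0 < cb ∧ ∀ R : ℕ, 1 ≤ R →
    ∃ θ c : ℝ, 0 < θ ∧ 0 < c ∧ ∃ N : ℕ, ∀ n : ℕ, N ≤ n → ∀ J : ℝ, 0 < J →
    ∃ (W Φ : Fin 2 → Set (Fin n × Fin n → ℤˣ))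
      (𝓑 : Fin 2 → Finset (Finset (Peierls.torus n).edgeSet))
      (𝓑out : Finset (Finset (Peierls.torus n).edgeSet)),
      -- a bottleneck structure symmetric under the global spin flip
      Peierls.IsSymmetricBottleneck R (Peierls.dwCheck (Peierls.torus n)) W Φ 𝓑 ∧
      -- the global Peierls condition with `Δ = 0.6 J` and `L = c n`
      Peierls.IsGlobalQPC 4 R
        (fun e => Peierls.diagOp (Peierls.dwCheck (Peierls.torus n) e))
        (Peierls.diagOp (Peierls.isingEnergy (Peierls.torus n) J))
        (6 / 10 * J) θ (c * (n : ℝ))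
        (fun k => Peierls.spanKets (W k)) (fun k => Peierls.spanKets (Φ k)) 𝓑 𝓑out ∧
      -- the order parameter: `P₁ A P₁ > 1/4` and `P₂ A P₂ < -1/4`
      (∀ ψ ∈ Peierls.spanKets (W 0) ⊔ Peierls.spanKets (Φ 0), ψ ≠ 0 →
        1 / 4 * ‖ψ‖ ^ 2 < Peierls.expectation (Peierls.magnetization (Fin n × Fin n)) ψ) ∧
      (∀ ψ ∈ Peierls.spanKets (W 1) ⊔ Peierls.spanKets (Φ 1), ψ ≠ 0 →
        Peierls.expectation (Peierls.magnetization (Fin n × Fin n)) ψ < -(1 / 4) * ‖ψ‖ ^ 2) ∧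
      -- the strengthened energy condition, for all indicators
      (∀ k, ∀ B ∈ 𝓑 k, ∃ A : Finset (Fin n × Fin n),
        Peierls.StrongEnergyCondition (Peierls.torus n) (Peierls.dwCheck (Peierls.torus n))
          (Peierls.isingEnergy (Peierls.torus n) J) (6 / 10 * J) cb B A ∧
        ∀ z ∈ W k ∪ Φ k, Peierls.AllExcited (Peierls.dwCheck (Peierls.torus n)) B z →
          Peierls.flipOn A z ∈ W k ∪ Φ k) ∧
      (∀ B ∈ 𝓑out, ∃ A : Finset (Fin n × Fin n),
        Peierls.StrongEnergyCondition (Peierls.torus n) (Peierls.dwCheck (Peierls.torus n))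
          (Peierls.isingEnergy (Peierls.torus n) J) (6 / 10 * J) cb B A) := by
  open Peierls in
  -- `L = n / (400 R)` bounds the length of every indicator from below; `θ` is such that `θ L = 7 n`
  refine ⟨1, one_pos, fun R hR => ⟨2800 * R, 1 / (400 * R), by positivity, by positivity,
    32 * R + 3, fun n hN J hJ => ?_⟩⟩
  have hn : 3 ≤ n := by omega
  have hRn : 32 * R < n := by omega
  have : NeZero n := ⟨by omega⟩
  refine ⟨well n R, rim n R, fun _ => edgeFamily hn (bottleneckWalls n (400 * R)),
    edgeFamily hn (outerWalls n), isSymmetricBottleneck_well hR hn hRn,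
    isGlobalQPC_well hR hn hRn hJ, ?_, ?_, ?_, ?_⟩
  · intro ψ hψ h0
    rw [spanKets_union, well_union_rim hR] at hψ
    rw [magnetization_eq_diagOp]
    refine lt_expectation_diagOp (fun z hz => ?_) hψ h0
    simpa [phaseSign] using phase_magnetization hz
  · intro ψ hψ h0
    rw [spanKets_union, well_union_rim hR] at hψ
    rw [magnetization_eq_diagOp, neg_mul, lt_neg, ← expectation_diagOp_neg]
    refine lt_expectation_diagOp (fun z hz => ?_) hψ h0
    simpa [phaseSign] using phase_magnetization hz
  · intro k B hB
    obtain ⟨B, hB₀, rfl⟩ := mem_edgeFamily.1 hB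
    obtain ⟨hf, -, hlt, -⟩ := mem_bottleneckWalls.1 hB₀
    obtain ⟨f, rfl, hflip⟩ := exists_flip_preserving_phase hf hlt
    refine ⟨_, strongEnergyCondition_domainWall hn hJ f, fun z hz hBz => ?_⟩
    rw [well_union_rim hR] at hz ⊢
    rw [flipOn_eq_mul]
    exact hflip _ z hz ((allExcited_iff hn).1 hBz)
  · intro B hB
    obtain ⟨B, hB₀, rfl⟩ := mem_edgeFamily.1 hB
    obtain ⟨f, rfl⟩ := (mem_outerWalls.1 hB₀).1
    exact ⟨_, strongEnergyCondition_domainWall hn hJ f⟩
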